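/- **Setting.** Let $n,p,q\ge 1$. The true parameters are $\Theta^0\in\mathbb R^{q\times p}$, $\Theta^0\ne 0$, a positive definite $\Lambda^0\in\mathbb R^{p\times p}$ and a positive definite $\Sigma^0_{xx}\in\mathbb R^{q\times q}$. The data $(X_i,Y_i)_{i\le n}$ are i.i.d. centred sub-Gaussian vectors in $\mathbb R^q\times\mathbb R^p$ such that $X_i$ has covariance $\Sigma^0_{xx}$ and, given $X_i$, $Y_i$ has mean $-(\Lambda^0)^{-1}(\Theta^0)^TX_i$ and covariance $(\Lambda^0)^{-1}$ (for instance $Y\mid X\sim N(-(\Lambda^0)^{-1}(\Theta^0)^TX,(\Lambda^0)^{-1})$). With $S_{yy}=\frac1n\sum Y_iY_i^T$, $S_{xy}=\frac1n\sum X_iY_i^T$, $S_{xx}=\frac1n\sum X_iX_i^T$ put $$l(\Theta,\Lambda)=\tfrac n2\big(\log\det\Lambda-\mathrm{tr}(S_{yy}\Lambda+2S_{xy}^T\Theta+\Lambda^{-1}\Theta^TS_{xx}\Theta)\big).$$ Let $0<\nu_0\le\nu_1$, $\eta,\rho\in[0,1]$, $LP(\phi,\nu)=\frac1{2\nu}e^{-|\phi|/\nu}$,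 $g(\phi)=\eta LP(\phi,\nu_1)+(1-\eta)LP(\phi,\nu_0)$, $$\Pi(\Theta)=\prod_i\Big[\rho\prod_jg(\Theta_{ij})+(1-\rho)\prod_jLP(\Theta_{ij},\nu_0)\Big],\qquad \Pi(\Lambda)=\prod_{i<j}g(\Lambda_{ij}),$$ and $L(\Theta,\Lambda)=-l(\Theta,\Lambda)-\log\Pi(\Theta)-\log\Pi(\Lambda)$. Let $R>\|\Lambda^0\|_2$. The HPD region is the set of all $(\Theta,\Lambda)$ with $\Lambda\succ0$, $\|\Lambda\|_2<R$ and $L(\Theta,\Lambda)\le L(\Theta^0,\Lambda^0)$. Let $|S^0_{row}|=p\cdot\#\{i:\Theta^0_{i\cdot}\ne0\}+\#\{(i,j):\Lambda^0_{ij}\ne0\}$, $\alpha=1+2\nu_1/\nu_0$, $\rho_1=0.5\min(\lambda_{\max}(\Lambda^0)^{-1},\lambda_{\min}(\Sigma^0_{xx}))$, $\rho_2=1.5\lambda_{\max}(\Sigma^0_{xx})$, $s_0=|S^0_{row}|+\lceil4(\rho_2/\rho_1)\alpha^2|S^0_{row}|\rceil$, $\tau=\lambda_{\max}[(\Theta^0)^T\Sigma^0_{xx}\Theta^0]$,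 $r_0=\min[0.5\lambda_{\min}(\Lambda^0),0.13\sqrt{\tau/\rho_2}]$, $\beta_0=\frac{\rho_1}{40\lambda_{\max}(\Lambda^0)}\min[1,\frac{\lambda_{\min}(3\Lambda^0)}{16\tau}]$. Two conditions concern the observed data: * (RIP) $0.5\,u^T\Sigma^0_{xx}u\le u^TS_{xx}u\le1.5\,u^T\Sigma^0_{xx}u$ for all $u\neq 0$ with at most $s_0$ nonzero entries, and $\lambda_{\max}[(\Theta^0)^TS_{xx}\Theta^0]\le1.4\,\tau$; * (G) $1/\nu_1>2\|\nabla l(\Theta^0,\Lambda^0)\|_\infty$, where $\|\cdot\|_\infty$ is the largest absolute value of an entry and $\nabla l$ is the matrix of partial derivatives in the individual entries of $\Theta$ and $\Lambda$. **Theorem.** For all $c_0,c_1,m>0$ there is a constant $C>0$, depending only on $c_0,c_1,m$, such that, with $$\epsilon_n:=\frac C{\beta_0}\sqrt{\frac{|S^0_{row}|\log(p+q)}n},$$ the following hold. 1. Let $\varepsilon_0\in(0,1)$ and assume $\lambda_{\min}(\Lambda^0)\ge m$, $n>(p+s_0)\log(p+q)/\varepsilon_0$, $\frac1{n\nu_0}\le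 c_0\sqrt{\frac{\log(p+q)}n}$, $\frac1{n\nu_1}\le c_1\sqrt{\frac{\log(p+q)}n}$ and $R<2\lambda_{\max}(\Lambda^0)\sqrt{r_0}/\epsilon_n$. Then almost surely, whenever the data satisfy (RIP) and (G), every $(\Theta,\Lambda)$ in the HPD region satisfies $$\|(\Theta,\Lambda)-(\Theta^0,\Lambda^0)\|_F\le\epsilon_n.$$ In particular, if (RIP) and (G) hold with probability at least $1-\varepsilon_0$, then with probability at least $1-\varepsilon_0$ this bound holds simultaneously for all $(\Theta,\Lambda)$ in the HPD region. 2. $\epsilon_n\to0$ as $n\to\infty$ if $p,q,\Theta^0,\Lambda^0,\Sigma^0_{xx}$ are fixed. If $p,q$, the true parameters and the hyperparameters vary with $n$, then $\epsilon_n\to0$ provided that $\beta_0$ stays bounded away from $0$ and that, for each constant $\varepsilon_0\in(0,1)$, $n>(p+s_0)\log(p+q)/\varepsilon_0$ for all large $n$. -/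

import Mathlib

open MeasureTheory ProbabilityTheory Filter Topology Matrix

namespace GCRF

noncomputable section

/-- Largest eigenvalue of a real symmetric matrix. -/
def lamMax {k : ℕ} (A : Matrix (Fin k) (Fin k) ℝ) : ℝ := sSup (spectrum ℝ A)

/-- Smallest eigenvalue of a real symmetric matrix. -/
def lamMin {k : ℕ} (A : Matrix (Fin k) (Fin k) ℝ) : ℝ := sInf (spectrum ℝ A)

/-- Spectral norm (Euclidean operator norm). -/
def specNorm {k : ℕ} (A : Matrix (Fin k) (Fin k) ℝ) : ℝ :=
  ‖Matrix.toEuclideanCLM (n := Fin k) (𝕜 := ℝ) A‖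

/-- The (uncentred) sample cross moment matrix `(1/n) ∑ xᵢ yᵢᵀ`. -/
def crossMoment {n a b : ℕ} (x : Fin n → Fin a → ℝ) (y : Fin n → Fin b → ℝ) :
    Matrix (Fin a) (Fin b) ℝ :=
  (1 / (n : ℝ)) • ∑ i, Matrix.vecMulVec (x i) (y i)

/-! ### True parameters and the constants that they determine -/

/-- The true parameters: `Θ⁰` (`q × p`), `Λ⁰` (`p × p`) and the covariance matrix `Σ⁰` of the
covariates (`q × q`). -/
structure Truth (p q : ℕ) where
  Θ : Matrix (Fin q) (Fin p) ℝ
  Λ : Matrix (Fin p) (Fin p) ℝ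
  Cov : Matrix (Fin q) (Fin q) ℝ

/-- Admissible true parameters. -/
structure Truth.Valid {p q : ℕ} (t : Truth p q) : Prop where
  Θ_ne : t.Θ ≠ 0
  Λ_pos : t.Λ.PosDef
  Cov_pos : t.Cov.PosDef

/-- Row-wise signal set of `Θ⁰`: all positions in the nonzero rows. -/
def Truth.SΘrow {p q : ℕ} (t : Truth p q) : Finset (Fin q × Fin p) :=
  Finset.univ.filter fun e => t.Θ e.1 ≠ 0

/-- Element-wise signal set of `Λ⁰`. -/
def Truth.SΛ {p q : ℕ} (t : Truth p q) : Finset (Fin p × Fin p) :=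
  Finset.univ.filter fun e => t.Λ e.1 e.2 ≠ 0

/-- Joint signal set, a set of positions of the pair `(Θ, Λ)`. -/
def Truth.Srow {p q : ℕ} (t : Truth p q) : Finset ((Fin q × Fin p) ⊕ (Fin p × Fin p)) :=
  t.SΘrow.disjSum t.SΛ

/-- `λ_max[(Θ⁰)ᵀ Σ⁰ Θ⁰]`. -/
def Truth.signal {p q : ℕ} (t : Truth p q) : ℝ := lamMax (t.Θᵀ * t.Cov * t.Θ)

def Truth.rho1 {p q : ℕ} (t : Truth p q) : ℝ := 0.5 * min (lamMax t.Λ)⁻¹ (lamMin t.Cov)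

def Truth.rho2 {p q : ℕ} (t : Truth p q) : ℝ := 1.5 * lamMax t.Cov

def Truth.r0 {p q : ℕ} (t : Truth p q) : ℝ :=
  min (0.5 * lamMin t.Λ) (0.13 * √(t.signal / t.rho2))

def Truth.beta0 {p q : ℕ} (t : Truth p q) : ℝ :=
  t.rho1 / (40 * lamMax t.Λ) * min 1 (lamMin ((3 : ℝ) • t.Λ) / (16 * t.signal))

/-- The rate `ε_n = (C / β₀) √(|S⁰_row| log (p + q) / n)`. -/
def Truth.rate {p q : ℕ} (t : Truth p q) (C : ℝ) (n : ℕ) : ℝ :=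
  C / t.beta0 * √((t.Srow.card : ℝ) * Real.log ((p : ℝ) + q) / n)

/-! ### Likelihood, prior, posterior -/

/-- Log-likelihood of the Gaussian conditional random field. -/
def logLik {n p q : ℕ} (x : Fin n → Fin q → ℝ) (y : Fin n → Fin p → ℝ)
    (Θ : Matrix (Fin q) (Fin p) ℝ) (Λ : Matrix (Fin p) (Fin p) ℝ) : ℝ :=
  (n : ℝ) / 2 * (Real.log Λ.det -
    (crossMoment y y * Λ + (2 : ℝ) • ((crossMoment x y)ᵀ * Θ)
      + Λ⁻¹ * Θᵀ * crossMoment x x * Θ).trace)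

/-- Partial derivative of the log-likelihood with respect to the entry `Θᵢⱼ`. -/
def gradΘ {n p q : ℕ} (x : Fin n → Fin q → ℝ) (y : Fin n → Fin p → ℝ)
    (Θ : Matrix (Fin q) (Fin p) ℝ) (Λ : Matrix (Fin p) (Fin p) ℝ) (i : Fin q) (j : Fin p) : ℝ :=
  deriv (fun s : ℝ => logLik x y (Θ + s • Matrix.single i j 1) Λ) 0

/-- Partial derivative of the log-likelihood with respect to the entry `Λᵢⱼ`
(matrix gradient: the entries of `Λ` are varied one at a time). -/
def gradΛ {n p q : ℕ} (x : Fin n → Fin q → ℝ) (y : Fin n → Fin p → ℝ)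
    (Θ : Matrix (Fin q) (Fin p) ℝ) (Λ : Matrix (Fin p) (Fin p) ℝ) (i j : Fin p) : ℝ :=
  deriv (fun s : ℝ => logLik x y Θ (Λ + s • Matrix.single i j 1)) 0

/-- `‖∇l(Θ, Λ)‖_∞`, the largest absolute value of an entry of the gradient. -/
def gradSup {n p q : ℕ} (x : Fin n → Fin q → ℝ) (y : Fin n → Fin p → ℝ)
    (Θ : Matrix (Fin q) (Fin p) ℝ) (Λ : Matrix (Fin p) (Fin p) ℝ) : ℝ :=
  max (⨆ e : Fin q × Fin p, |gradΘ x y Θ Λ e.1 e.2|)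
    (⨆ e : Fin p × Fin p, |gradΛ x y Θ Λ e.1 e.2|)

/-- Hyperparameters: spike scale `ν₀`, slab scale `ν₁`, element-level weight `η`, row-level
weight `ρ`, and the bound `R` on the spectral norm of `Λ`. -/
structure Hyper where
  ν0 : ℝ
  ν1 : ℝ
  η : ℝ
  ρ : ℝ
  R : ℝ

/-- Admissible hyperparameters; the weights `0` and `1` (Lasso penalty) are allowed. -/
structure Hyper.Valid (h : Hyper) : Prop where
  ν0_pos : 0 < h.ν0
  ν_le : h.ν0 ≤ h.ν1
  η_mem : h.η ∈ Set.Icc (0 : ℝ) 1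
  ρ_mem : h.ρ ∈ Set.Icc (0 : ℝ) 1

/-- Laplace density. -/
def LP (φ ν : ℝ) : ℝ := 1 / (2 * ν) * Real.exp (-|φ| / ν)

/-- Spike and slab Lasso density. -/
def ssl (h : Hyper) (φ : ℝ) : ℝ := h.η * LP φ h.ν1 + (1 - h.η) * LP φ h.ν0

/-- Prior density of `Θ`. -/
def priorΘ {p q : ℕ} (h : Hyper) (Θ : Matrix (Fin q) (Fin p) ℝ) : ℝ :=
  ∏ i, (h.ρ * ∏ j, ssl h (Θ i j) + (1 - h.ρ) * ∏ j, LP (Θ i j) h.ν0)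

/-- Prior density of `Λ` (off-diagonal part; the diagonal has a uniform prior). -/
def priorΛ {p : ℕ} (h : Hyper) (Λ : Matrix (Fin p) (Fin p) ℝ) : ℝ :=
  ∏ i, ∏ j ∈ Finset.Ioi i, ssl h (Λ i j)

/-- Negative log-posterior (up to an additive constant). -/
def negLogPost {n p q : ℕ} (h : Hyper) (x : Fin n → Fin q → ℝ) (y : Fin n → Fin p → ℝ)
    (Θ : Matrix (Fin q) (Fin p) ℝ) (Λ : Matrix (Fin p) (Fin p) ℝ) : ℝ :=
  -logLik x y Θ Λ - Real.log (priorΘ h Θ) - Real.log (priorΛ h Λ)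

/-- The high posterior density region, inside the parameter space `Λ ≻ 0`, `‖Λ‖₂ < R`. -/
def HPD {n p q : ℕ} (h : Hyper) (t : Truth p q) (x : Fin n → Fin q → ℝ)
    (y : Fin n → Fin p → ℝ) : Set (Matrix (Fin q) (Fin p) ℝ × Matrix (Fin p) (Fin p) ℝ) :=
  {Φ | Φ.2.PosDef ∧ specNorm Φ.2 < h.R ∧
    negLogPost h x y Φ.1 Φ.2 ≤ negLogPost h x y t.Θ t.Λ}

/-- Frobenius distance `‖(Θ, Λ) - (Θ⁰, Λ⁰)‖_F`. -/
def frobDist {p q : ℕ} (t : Truth p q)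
    (Φ : Matrix (Fin q) (Fin p) ℝ × Matrix (Fin p) (Fin p) ℝ) : ℝ :=
  √((∑ i, ∑ j, (Φ.1 i j - t.Θ i j) ^ 2) + ∑ i, ∑ j, (Φ.2 i j - t.Λ i j) ^ 2)

/-! ### Assumptions -/

def Hyper.alpha (h : Hyper) : ℝ := 1 + 2 * h.ν1 / h.ν0

/-- The sparsity level `s₀` of the restricted isometry property. -/
def sparsity {p q : ℕ} (t : Truth p q) (h : Hyper) : ℕ :=
  t.Srow.card + ⌈4 * (t.rho2 / t.rho1) * h.alpha ^ 2 * (t.Srow.card : ℝ)⌉₊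

/-- The restricted isometry property of the sample covariates; `hammingNorm u` is the number
of nonzero entries of `u`. The ratios are cleared of their (positive) denominators. -/
structure RIP {n p q : ℕ} (t : Truth p q) (h : Hyper) (x : Fin n → Fin q → ℝ) : Prop where
  lower : ∀ u : Fin q → ℝ, u ≠ 0 → hammingNorm u ≤ sparsity t h →
    0.5 * (u ⬝ᵥ t.Cov *ᵥ u) ≤ u ⬝ᵥ crossMoment x x *ᵥ u
  upper : ∀ u : Fin q → ℝ, u ≠ 0 → hammingNorm u ≤ sparsity t h →
    u ⬝ᵥ crossMoment x x *ᵥ u ≤ 1.5 * (u ⬝ᵥ t.Cov *ᵥ u)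
  signal : lamMax (t.Θᵀ * crossMoment x x * t.Θ) ≤ 1.4 * t.signal

/-- The sample-size assumption `n > (p + s₀) log (p + q) / ε₀`. -/
def SampleSize {p q : ℕ} (t : Truth p q) (h : Hyper) (n : ℕ) (ε0 : ℝ) : Prop :=
  ((p : ℝ) + sparsity t h) * Real.log ((p : ℝ) + q) / ε0 < n

/-- The noise `Yᵢ - B⁰ Xᵢ`, where `B⁰ = -(Λ⁰)⁻¹ (Θ⁰)ᵀ`. -/
def noise {Ω : Type*} {n p q : ℕ} (t : Truth p q) (X : Fin n → Ω → Fin q → ℝ)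
    (Y : Fin n → Ω → Fin p → ℝ) (i : Fin n) (ω : Ω) : Fin p → ℝ :=
  Y i ω - (-(t.Λ⁻¹ * t.Θᵀ)) *ᵥ X i ω

/-- The data are `n` i.i.d. copies of a centred sub-Gaussian vector `(X, Y)` such that `X` has
covariance `Σ⁰` and, given `X`, `Y` has mean `B⁰ X` and covariance `(Λ⁰)⁻¹`. -/
structure IsSample {Ω : Type*} [MeasurableSpace Ω] {n p q : ℕ} (μ : Measure Ω) (t : Truth p q)
    (X : Fin n → Ω → Fin q → ℝ) (Y : Fin n → Ω → Fin p → ℝ) : Prop where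
  measX : ∀ i, Measurable (X i)
  measY : ∀ i, Measurable (Y i)
  indep : iIndepFun (fun i ω => (X i ω, Y i ω)) μ
  ident : ∀ i j, IdentDistrib (fun ω => (X i ω, Y i ω)) (fun ω => (X j ω, Y j ω)) μ μ
  subG : ∀ i (u : Fin q → ℝ) (v : Fin p → ℝ),
    ∃ c, HasSubgaussianMGF (fun ω => u ⬝ᵥ X i ω + v ⬝ᵥ Y i ω) c μ
  covX : ∀ i j k, ∫ ω, X i ω j * X i ω k ∂μ = t.Cov j k
  condMean : ∀ i j, μ[fun ω => noise t X Y i ω j | MeasurableSpace.comap (X i) inferInstance]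
    =ᵐ[μ] fun _ => 0
  condCov : ∀ i j k,
    μ[fun ω => noise t X Y i ω j * noise t X Y i ω k |
      MeasurableSpace.comap (X i) inferInstance] =ᵐ[μ] fun _ => t.Λ⁻¹ j k

/-- The two assumptions on the observed data: the restricted isometry property and
`1/ν₁ > 2 ‖∇l(Θ⁰, Λ⁰)‖_∞`. -/
def GoodData {n p q : ℕ} (t : Truth p q) (h : Hyper) (x : Fin n → Fin q → ℝ)
    (y : Fin n → Fin p → ℝ) : Prop :=
  RIP t h x ∧ 2 * gradSup x y t.Θ t.Λ < 1 / h.ν1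

/-- Every point of the HPD region is within `ε` of the truth. -/
def HPDWithin {n p q : ℕ} (t : Truth p q) (h : Hyper) (x : Fin n → Fin q → ℝ)
    (y : Fin n → Fin p → ℝ) (ε : ℝ) : Prop :=
  ∀ Φ ∈ HPD h t x y, frobDist t Φ ≤ ε

end

end GCRF

open GCRF

/-!
The bound is deterministic: it holds at every outcome at which the data are good, and the
probabilistic claims follow by inclusion of events.

Write `Δ = (Θ, Λ) - (Θ⁰, Λ⁰)`. Because `tr(Λ⁻¹ Θᵀ S Θ)` is homogeneous of degree one in `(Θ, Λ)`, the
first-order expansion of `-(2/n) l` at the truth has the *exact* remainder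

  `D = [log det Λ⁰ - log det Λ + tr((Λ⁰)⁻¹ Δ_Λ)] + tr(Λ⁻¹ Wᵀ S W)`,
  `W = Δ_Θ - Θ⁰ (Λ⁰)⁻¹ Δ_Λ`

(`logLik_sub_eq`). Along the coordinates off the signal set the negative log-prior grows at least at
slope `1/ν₁`, and anywhere at most at slope `1/ν₀` (`log_priorΘ_sub_le`, `log_priorΛ_sub_le`). Since
`1/ν₁` exceeds twice the gradient, every point of the HPD region satisfies
`(n/2) D ≤ (1/ν₀ + 1/(2ν₁)) ‖Δ_S‖₁ - (1/(2ν₁)) ‖Δ_{Θ,Sᶜ}‖₁` (`divergence_le_of_mem_HPD`). This gives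
both `D = O(c₀ β₀ ε_n ‖Δ‖ / C)` and the cone condition `‖Δ_{Θ,Sᶜ}‖₁ ≤ α ‖Δ_S‖₁`.

On that cone `D` is bounded below. Put `κ = 1 + ‖Δ_Λ‖_F / λ_min(Λ⁰)`, so that `Λ ≤ κ Λ⁰`. Then the
log-determinant part is at least `tr((Λ⁰)⁻¹ Δ_Λ (Λ⁰)⁻¹ Δ_Λ) / (4κ)` (`logDet_divergence_ge`), the
second part is at least `tr((Λ⁰)⁻¹ Wᵀ S W) / κ` (`energy_le`), and the cross term hidden in `W` is
paid for by the first part, at the price of the factor `min(1, λ_min(3Λ⁰) / (16τ))` of `β₀`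
(`energy_mul_inv_mul_le`). The restricted isometry property bounds `tr(Δ_Θᵀ S Δ_Θ)` below on the
cone, after the entries of `Δ_Θ` off the signal set are cut into blocks of decreasing size
(`exists_block_seminorm_le`, `exists_restricted_eigenvalue`). Altogether
`κ D ≥ β₀ ‖Δ‖_F² / 4` (`beta0_mul_le_divergence`).

If `‖Δ‖_F > ε_n`, then `κ ≤ (1 + ε_n / λ_min(Λ⁰)) ‖Δ‖_F / ε_n`, and the bound on `R` makes
`ε_n / λ_min(Λ⁰)` at most `√(2/m)`. So no localization of `Λ` near `Λ⁰` is needed: the two bounds on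
`D` contradict each other once `C` is large in terms of `c₀` and `m` (`HPDWithin_of_goodData`).
-/

namespace GCRF

/-! ### Extreme eigenvalues and quadratic forms -/

lemma finite_spectrum {k : ℕ} (A : Matrix (Fin k) (Fin k) ℝ) : (spectrum ℝ A).Finite :=
  Matrix.finite_spectrum A

lemma quadForm_nonneg {k : ℕ} {A : Matrix (Fin k) (Fin k) ℝ} (hA : A.PosSemidef)
    (u : Fin k → ℝ) : 0 ≤ u ⬝ᵥ A *ᵥ u := by
  simpa using hA.dotProduct_mulVec_nonneg u

lemma quadForm_pos {k : ℕ} {A : Matrix (Fin k) (Fin k) ℝ} (hA : A.PosDef)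
    {u : Fin k → ℝ} (hu : u ≠ 0) : 0 < u ⬝ᵥ A *ᵥ u := by
  simpa using hA.dotProduct_mulVec_pos hu

lemma isSymm_of_isHermitian {k : ℕ} {A : Matrix (Fin k) (Fin k) ℝ} (hA : A.IsHermitian) :
    Aᵀ = A := by
  simpa [Matrix.IsHermitian, conjTranspose_eq_transpose_of_trivial] using hA

lemma lamMin_mul_le {k : ℕ} {A : Matrix (Fin k) (Fin k) ℝ} (hA : A.IsHermitian)
    (u : Fin k → ℝ) : lamMin A * (u ⬝ᵥ u) ≤ u ⬝ᵥ A *ᵥ u := by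
  have h : (A - algebraMap ℝ _ (lamMin A)).PosSemidef := by
    rw [posSemidef_iff_isHermitian_and_spectrum_nonneg]
    refine ⟨hA.sub ?_, ?_⟩
    · rw [Algebra.algebraMap_eq_smul_one]
      exact isHermitian_one.smul (by simp [IsSelfAdjoint])
    · rw [← spectrum.sub_singleton_eq]
      rintro _ ⟨a, ha, b, rfl, rfl⟩
      exact sub_nonneg.2 (csInf_le (finite_spectrum A).bddBelow ha)
  have := quadForm_nonneg h u
  rw [Algebra.algebraMap_eq_smul_one, sub_mulVec, dotProduct_sub, smul_mulVec, one_mulVec,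
    dotProduct_smul, smul_eq_mul] at this
  linarith

lemma le_lamMax_mul {k : ℕ} {A : Matrix (Fin k) (Fin k) ℝ} (hA : A.IsHermitian)
    (u : Fin k → ℝ) : u ⬝ᵥ A *ᵥ u ≤ lamMax A * (u ⬝ᵥ u) := by
  have h : (algebraMap ℝ _ (lamMax A) - A).PosSemidef := by
    rw [posSemidef_iff_isHermitian_and_spectrum_nonneg]
    refine ⟨IsHermitian.sub ?_ hA, ?_⟩
    · rw [Algebra.algebraMap_eq_smul_one]
      exact isHermitian_one.smul (by simp [IsSelfAdjoint])
    · rw [← spectrum.singleton_sub_eq]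
      rintro _ ⟨b, rfl, a, ha, rfl⟩
      exact sub_nonneg.2 (le_csSup (finite_spectrum A).bddAbove ha)
  have := quadForm_nonneg h u
  rw [Algebra.algebraMap_eq_smul_one, sub_mulVec, dotProduct_sub, smul_mulVec, one_mulVec,
    dotProduct_smul, smul_eq_mul] at this
  linarith

lemma spectrum_nonempty {k : ℕ} (hk : 0 < k) {A : Matrix (Fin k) (Fin k) ℝ}
    (hA : A.IsHermitian) : (spectrum ℝ A).Nonempty :=
  ⟨_, hA.eigenvalues_mem_spectrum_real ⟨0, hk⟩⟩

lemma lamMin_pos {k : ℕ} (hk : 0 < k) {A : Matrix (Fin k) (Fin k) ℝ} (hA : A.PosDef) :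
    0 < lamMin A := by
  have h := (spectrum_nonempty hk hA.isHermitian).csInf_mem (finite_spectrum A)
  rw [hA.isHermitian.spectrum_real_eq_range_eigenvalues] at h
  obtain ⟨i, hi⟩ := h
  rw [lamMin, hA.isHermitian.spectrum_real_eq_range_eigenvalues, ← hi]
  exact hA.eigenvalues_pos i

lemma lamMin_le_lamMax {k : ℕ} (hk : 0 < k) {A : Matrix (Fin k) (Fin k) ℝ}
    (hA : A.IsHermitian) : lamMin A ≤ lamMax A := by
  obtain ⟨a, ha⟩ := spectrum_nonempty hk hA
  exact (csInf_le (finite_spectrum A).bddBelow ha).trans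
    (le_csSup (finite_spectrum A).bddAbove ha)

lemma lamMax_le_specNorm {k : ℕ} (hk : 0 < k) {A : Matrix (Fin k) (Fin k) ℝ}
    (hA : A.IsHermitian) : lamMax A ≤ specNorm A := by
  have : Nonempty (Fin k) := ⟨⟨0, hk⟩⟩
  refine csSup_le (spectrum_nonempty hk hA) fun a ha => ?_
  rw [← AlgEquiv.spectrum_eq (Matrix.toEuclideanCLM (n := Fin k) (𝕜 := ℝ)) A] at ha
  exact (le_abs_self a).trans (spectrum.norm_le_norm_of_mem ha)

/-- Positive definite `A ≥ κ⁻¹ B` gives `A⁻¹ ≤ κ B⁻¹`, by the variational formula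
`w ⬝ B⁻¹ w = sup_u (2 w ⬝ u - u ⬝ B u)` at `u = κ⁻¹ A⁻¹ w`. -/
lemma quadForm_inv_le {k : ℕ} {A B : Matrix (Fin k) (Fin k) ℝ} (hA : A.PosDef) (hB : B.PosDef)
    {κ : ℝ} (hκ : 0 < κ) (h : ∀ u, u ⬝ᵥ B *ᵥ u ≤ κ * (u ⬝ᵥ A *ᵥ u)) (w : Fin k → ℝ) :
    w ⬝ᵥ A⁻¹ *ᵥ w ≤ κ * (w ⬝ᵥ B⁻¹ *ᵥ w) := by
  have hAu : A * A⁻¹ = 1 := A.mul_nonsing_inv hA.det_pos.ne'.isUnit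
  have hBu : B * B⁻¹ = 1 := B.mul_nonsing_inv hB.det_pos.ne'.isUnit
  set a := A⁻¹ *ᵥ w with ha
  set b := B⁻¹ *ᵥ w with hb
  have hAa : A *ᵥ a = w := by rw [ha, mulVec_mulVec, hAu, one_mulVec]
  have hBb : B *ᵥ b = w := by rw [hb, mulVec_mulVec, hBu, one_mulVec]
  have h1 := quadForm_nonneg hB.posSemidef (b - κ⁻¹ • a)
  have h2 := h a
  have h3 : b ⬝ᵥ B *ᵥ a = w ⬝ᵥ a := by
    rw [dotProduct_mulVec, ← mulVec_transpose, isSymm_of_isHermitian hB.isHermitian, hBb]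
  rw [hAa] at h2
  rw [mulVec_sub, mulVec_smul, hBb, dotProduct_sub, sub_dotProduct, sub_dotProduct,
    dotProduct_smul, dotProduct_smul, smul_dotProduct, smul_dotProduct, h3, dotProduct_comm b w,
    dotProduct_comm a w] at h1
  rw [dotProduct_comm a w] at h2
  simp only [smul_eq_mul] at h1
  have h4 : κ⁻¹ * (κ⁻¹ * (a ⬝ᵥ B *ᵥ a)) ≤ κ⁻¹ * (w ⬝ᵥ a) := by
    refine mul_le_mul_of_nonneg_left ?_ (inv_nonneg.2 hκ.le)
    rw [inv_mul_le_iff₀ hκ]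
    exact h2
  have h5 : κ⁻¹ * (w ⬝ᵥ a) ≤ w ⬝ᵥ b := by linarith
  rwa [inv_mul_le_iff₀ hκ] at h5

/-! ### Traces as sums of quadratic forms -/

lemma trace_mul_mul_transpose {a b : Type*} [Fintype a] [Fintype b] (L : Matrix a b ℝ)
    (C : Matrix b b ℝ) : (L * C * Lᵀ).trace = ∑ i, L i ⬝ᵥ C *ᵥ L i := by
  refine Finset.sum_congr rfl fun i _ => ?_
  rw [dotProduct_mulVec, diag_apply, Matrix.mul_apply]
  rfl

lemma trace_mono {a b : Type*} [Fintype a] [Fintype b] (L : Matrix a b ℝ)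
    {C D : Matrix b b ℝ} {c : ℝ} (h : ∀ u, u ⬝ᵥ C *ᵥ u ≤ c * (u ⬝ᵥ D *ᵥ u)) :
    (L * C * Lᵀ).trace ≤ c * (L * D * Lᵀ).trace := by
  rw [trace_mul_mul_transpose, trace_mul_mul_transpose, Finset.mul_sum]
  exact Finset.sum_le_sum fun i _ => h _

lemma trace_mul_transpose_self {a b : Type*} [Fintype a] [Fintype b] (L : Matrix a b ℝ) :
    (L * Lᵀ).trace = ∑ i, ∑ j, L i j ^ 2 := by
  simp [trace, mul_apply, sq]

lemma crossMoment_self_eq {n q : ℕ} (x : Fin n → Fin q → ℝ) :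
    crossMoment x x = (1 / (n : ℝ)) • ((Matrix.of x)ᵀ * Matrix.of x) := by
  ext i j
  simp [crossMoment, mul_apply, Matrix.sum_apply, vecMulVec_apply]

lemma isSymm_crossMoment {n q : ℕ} (x : Fin n → Fin q → ℝ) :
    (crossMoment x x)ᵀ = crossMoment x x := by
  rw [crossMoment_self_eq, transpose_smul, transpose_mul, transpose_transpose]

/-- The trace of `A Vᵀ S V`, with `S` the second moment matrix of the sample. -/
lemma trace_crossMoment {n p q : ℕ} (x : Fin n → Fin q → ℝ) (A : Matrix (Fin p) (Fin p) ℝ)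
    (V : Matrix (Fin q) (Fin p) ℝ) :
    (A * Vᵀ * crossMoment x x * V).trace =
      1 / (n : ℝ) * ((Matrix.of x * V) * A * (Matrix.of x * V)ᵀ).trace := by
  rw [crossMoment_self_eq, Matrix.mul_smul, Matrix.smul_mul, trace_smul, smul_eq_mul]
  congr 1
  rw [transpose_mul, Matrix.mul_assoc (Matrix.of x), Matrix.mul_assoc (Matrix.of x),
    trace_mul_comm (Matrix.of x), ← Matrix.mul_assoc (V * A), Matrix.mul_assoc (V * A * Vᵀ),
    Matrix.mul_assoc V, Matrix.mul_assoc V, trace_mul_comm V]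

/-! ### The log-determinant divergence -/

lemma sq_le_sub_one_sub_log {l κ : ℝ} (hl : 0 < l) (hlκ : l ≤ κ) (hκ : 1 ≤ κ) :
    (l - 1) ^ 2 / (4 * κ) ≤ l - 1 - Real.log l := by
  -- with `s = √l`, both sides are compared with `(s - 1) ^ 2`
  set s := √l
  have hs0 : 0 < s := Real.sqrt_pos.2 hl
  have hsq : s ^ 2 = l := Real.sq_sqrt hl.le
  have hlog : Real.log l = 2 * Real.log s := by rw [← hsq, Real.log_pow]; norm_num
  have h1 := Real.log_le_sub_one_of_pos hs0
  have h2 : (l - 1) ^ 2 / (4 * κ) ≤ (s - 1) ^ 2 := by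
    rw [div_le_iff₀ (by positivity), ← hsq]
    have : (s + 1) ^ 2 ≤ 4 * κ := by nlinarith [sq_nonneg (s - 1)]
    nlinarith [mul_le_mul_of_nonneg_left this (sq_nonneg (s - 1))]
  nlinarith

lemma trace_mul_self_eq_sum {k : ℕ} {M : Matrix (Fin k) (Fin k) ℝ} (hM : M.IsHermitian) :
    (M * M).trace = ∑ i, hM.eigenvalues i ^ 2 := by
  conv_lhs => rw [hM.spectral_theorem, ← map_mul, Unitary.conjStarAlgAut_apply, trace_mul_cycle,
    Unitary.coe_star_mul_self, one_mul, diagonal_mul_diagonal, trace_diagonal]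
  simp [sq]

lemma eigenvalues_le {k : ℕ} {M : Matrix (Fin k) (Fin k) ℝ} (hM : M.IsHermitian) {κ : ℝ}
    (h : ∀ u, u ⬝ᵥ M *ᵥ u ≤ κ * (u ⬝ᵥ u)) (i : Fin k) : hM.eigenvalues i ≤ κ := by
  have hv := hM.mulVec_eigenvectorBasis i
  set v : Fin k → ℝ := ⇑(hM.eigenvectorBasis i)
  have hne : v ≠ 0 := by
    intro h0
    have h1 := hM.eigenvectorBasis.orthonormal.ne_zero i
    exact h1 (PiLp.ext fun j => by simpa using congrFun h0 j)
  have hpos : 0 < v ⬝ᵥ v := by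
    have := dotProduct_self_star_pos_iff.2 hne
    simpa using this
  have := h v
  rw [hv, dotProduct_smul, smul_eq_mul] at this
  exact le_of_mul_le_mul_right this hpos

lemma trace_sq_le_trace_sub_log_det {k : ℕ} {M : Matrix (Fin k) (Fin k) ℝ} (hM : M.PosDef)
    {κ : ℝ} (hκ : 1 ≤ κ) (h : ∀ u, u ⬝ᵥ M *ᵥ u ≤ κ * (u ⬝ᵥ u)) :
    ((M * M).trace - 2 * M.trace + k) / (4 * κ) ≤ M.trace - k - Real.log M.det := by
  have hH := hM.isHermitian
  have hdet : Real.log M.det = ∑ i, Real.log (hH.eigenvalues i) := by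
    rw [hH.det_eq_prod_eigenvalues]
    simpa using Real.log_prod (s := Finset.univ) (f := hH.eigenvalues)
      (fun i _ => (hM.eigenvalues_pos i).ne')
  have htr : M.trace = ∑ i, hH.eigenvalues i := by simpa using hH.trace_eq_sum_eigenvalues
  have hk : (k : ℝ) = ∑ _i : Fin k, (1 : ℝ) := by simp
  rw [hdet, htr, trace_mul_self_eq_sum hH, hk, Finset.mul_sum, ← Finset.sum_sub_distrib,
    ← Finset.sum_add_distrib, ← Finset.sum_sub_distrib, ← Finset.sum_sub_distrib, Finset.sum_div]
  refine Finset.sum_le_sum fun i _ => ?_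
  refine le_trans (le_of_eq ?_)
    (sq_le_sub_one_sub_log (hM.eigenvalues_pos i) (eigenvalues_le hH h i) hκ)
  ring

lemma exists_mul_transpose_eq_inv {k : ℕ} {A : Matrix (Fin k) (Fin k) ℝ} (hA : A.PosDef) :
    ∃ G : Matrix (Fin k) (Fin k) ℝ, G * Gᵀ = A⁻¹ := by
  open scoped MatrixOrder in
  obtain ⟨y, hy⟩ := CStarAlgebra.nonneg_iff_eq_star_mul_self.mp hA.inv.posSemidef.nonneg
  exact ⟨yᵀ, by rw [hy, star_eq_conjTranspose, conjTranspose_eq_transpose_of_trivial,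
    transpose_transpose]⟩

/-- The log-determinant divergence of `B` from `A` dominates the squared Frobenius norm of
`A^(-1/2) (B - A) A^(-1/2)`, up to the factor by which `B` may exceed `A`. -/
lemma logDet_divergence_ge {k : ℕ} {A B : Matrix (Fin k) (Fin k) ℝ} (hA : A.PosDef)
    (hB : B.PosDef) {κ : ℝ} (hκ : 1 ≤ κ) (h : ∀ u, u ⬝ᵥ B *ᵥ u ≤ κ * (u ⬝ᵥ A *ᵥ u)) :
    (A⁻¹ * (B - A) * A⁻¹ * (B - A)).trace / (4 * κ) ≤
      Real.log A.det - Real.log B.det + (A⁻¹ * (B - A)).trace := by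
  obtain ⟨G, hG⟩ := exists_mul_transpose_eq_inv hA
  have hAi : A⁻¹ * A = 1 := A.nonsing_inv_mul hA.det_pos.ne'.isUnit
  have hdetG : G.det * G.det = (A.det)⁻¹ := by
    have := congrArg Matrix.det hG
    rwa [det_mul, det_transpose, det_nonsing_inv, Ring.inverse_eq_inv'] at this
  have hG0 : G.det ≠ 0 := fun h0 => by
    rw [h0, mul_zero] at hdetG
    exact inv_ne_zero hA.det_pos.ne' hdetG.symm
  have hGu : IsUnit G.det := hG0.isUnit
  have hGAG : Gᵀ * A * G = 1 := by
    have h1 : G * (Gᵀ * A * G) = G * 1 := by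
      rw [← Matrix.mul_assoc, ← Matrix.mul_assoc, hG, hAi, Matrix.one_mul, Matrix.mul_one]
    have := congrArg (G⁻¹ * ·) h1
    simpa [← Matrix.mul_assoc, nonsing_inv_mul G hGu] using this
  set M := Gᵀ * B * G with hMdef
  have hquad : ∀ (C : Matrix (Fin k) (Fin k) ℝ) (u : Fin k → ℝ),
      u ⬝ᵥ (Gᵀ * C * G) *ᵥ u = (G *ᵥ u) ⬝ᵥ C *ᵥ (G *ᵥ u) := by
    intro C u
    rw [← mulVec_mulVec, ← mulVec_mulVec, dotProduct_mulVec, vecMul_transpose]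
  have hM : M.PosDef := by
    have := hB.conjTranspose_mul_mul_same (B := G)
      (mulVec_injective_iff_isUnit.2 ((isUnit_iff_isUnit_det G).2 hGu))
    rwa [conjTranspose_eq_transpose_of_trivial] at this
  have hMle : ∀ u, u ⬝ᵥ M *ᵥ u ≤ κ * (u ⬝ᵥ u) := by
    intro u
    have h1 := h (G *ᵥ u)
    rwa [← hquad, ← hquad, hGAG, one_mulVec] at h1
  have key := trace_sq_le_trace_sub_log_det hM hκ hMle
  have htr : M.trace = (A⁻¹ * B).trace := by
    rw [hMdef, trace_mul_comm, ← Matrix.mul_assoc, hG]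
  have htr2 : (M * M).trace = (A⁻¹ * B * A⁻¹ * B).trace := by
    have h1 : M * M = Gᵀ * (B * A⁻¹ * B * G) := by
      rw [hMdef, ← hG]; simp only [Matrix.mul_assoc]
    rw [h1, trace_mul_comm, Matrix.mul_assoc, hG, trace_mul_comm]
    simp only [Matrix.mul_assoc]
  have hdet : Real.log M.det = Real.log B.det - Real.log A.det := by
    have : M.det = B.det / A.det := by
      rw [hMdef, det_mul, det_mul, det_transpose, div_eq_mul_inv, ← hdetG]; ring
    rw [this, Real.log_div hB.det_pos.ne' hA.det_pos.ne']
  have h1 : A⁻¹ * (B - A) = A⁻¹ * B - 1 := by rw [Matrix.mul_sub, hAi]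
  have h2 : A⁻¹ * (B - A) * A⁻¹ * (B - A) = A⁻¹ * B * A⁻¹ * B - A⁻¹ * B - A⁻¹ * B + 1 := by
    rw [Matrix.mul_assoc (A⁻¹ * (B - A)), h1, Matrix.mul_sub, Matrix.sub_mul]
    simp only [Matrix.mul_assoc, Matrix.one_mul, Matrix.mul_one]
    abel
  have h3 : (1 : Matrix (Fin k) (Fin k) ℝ).trace = k := by simp
  rw [h2, h1, trace_add, trace_sub, trace_sub, trace_sub, h3]
  rw [htr, htr2, hdet] at key
  refine le_trans (le_of_eq ?_) (key.trans (le_of_eq ?_)) <;> ring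

/-! ### Quadratic energies of the two parameter blocks -/

/-- The energy `tr(A⁻¹ Vᵀ S V)` of a coefficient matrix `V`, where `S` is the second moment matrix
of the covariates and `A` a precision matrix. -/
noncomputable def energy {n p q : ℕ} (x : Fin n → Fin q → ℝ) (A : Matrix (Fin p) (Fin p) ℝ)
    (V : Matrix (Fin q) (Fin p) ℝ) : ℝ :=
  (A⁻¹ * Vᵀ * crossMoment x x * V).trace

lemma energy_eq {n p q : ℕ} (x : Fin n → Fin q → ℝ) (A : Matrix (Fin p) (Fin p) ℝ)
    (V : Matrix (Fin q) (Fin p) ℝ) :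
    energy x A V = 1 / (n : ℝ) * ((Matrix.of x * V) * A⁻¹ * (Matrix.of x * V)ᵀ).trace :=
  trace_crossMoment x A⁻¹ V

lemma energy_le {n p q : ℕ} (x : Fin n → Fin q → ℝ) {A B : Matrix (Fin p) (Fin p) ℝ}
    (hA : A.PosDef) (hB : B.PosDef) {κ : ℝ} (hκ : 0 < κ)
    (h : ∀ u, u ⬝ᵥ B *ᵥ u ≤ κ * (u ⬝ᵥ A *ᵥ u)) (V : Matrix (Fin q) (Fin p) ℝ) :
    energy x A V ≤ κ * energy x B V := by
  rw [energy_eq, energy_eq, mul_left_comm]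
  exact mul_le_mul_of_nonneg_left (trace_mono _ (quadForm_inv_le hA hB hκ h)) (by positivity)

lemma energy_nonneg {n p q : ℕ} (x : Fin n → Fin q → ℝ) {A : Matrix (Fin p) (Fin p) ℝ}
    (hA : A.PosDef) (V : Matrix (Fin q) (Fin p) ℝ) : 0 ≤ energy x A V := by
  rw [energy_eq, trace_mul_mul_transpose]
  exact mul_nonneg (by positivity)
    (Finset.sum_nonneg fun i _ => quadForm_nonneg hA.inv.posSemidef _)

lemma energy_le_two_mul_add {n p q : ℕ} (x : Fin n → Fin q → ℝ) {A : Matrix (Fin p) (Fin p) ℝ}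
    (hA : A.PosDef) (U V : Matrix (Fin q) (Fin p) ℝ) :
    energy x A U ≤ 2 * energy x A (U - V) + 2 * energy x A V := by
  have h := energy_nonneg x hA (U - V - V)
  have e : ∀ W : Matrix (Fin q) (Fin p) ℝ, energy x A (W - V) + energy x A (W + V) =
      2 * energy x A W + 2 * energy x A V := by
    intro W
    simp only [energy, transpose_sub, transpose_add, Matrix.mul_sub, Matrix.sub_mul,
      Matrix.mul_add, Matrix.add_mul, trace_add, trace_sub]
    ring
  have := e (U - V)
  rw [sub_add_cancel] at this
  linarith

lemma energy_one_eq {n p q : ℕ} (x : Fin n → Fin q → ℝ) (V : Matrix (Fin q) (Fin p) ℝ) :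
    energy x 1 V = 1 / (n : ℝ) * ∑ i, ∑ j, (Matrix.of x * V) i j ^ 2 := by
  rw [energy_eq, inv_one, Matrix.mul_one, trace_mul_transpose_self]

/-- `tr(A⁻¹ Δ A⁻¹ Δ)` is the squared Frobenius norm of `A^(-1/2) Δ A^(-1/2)`. -/
lemma sum_sq_le_trace {k : ℕ} {A Δ : Matrix (Fin k) (Fin k) ℝ} (hA : A.PosDef) (hΔ : Δᵀ = Δ)
    {L : ℝ} (hL : 0 < L) (h : ∀ u, u ⬝ᵥ A *ᵥ u ≤ L * (u ⬝ᵥ u)) :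
    ∑ i, ∑ j, Δ i j ^ 2 ≤ L ^ 2 * (A⁻¹ * Δ * A⁻¹ * Δ).trace := by
  obtain ⟨G, hG⟩ := exists_mul_transpose_eq_inv hA
  have hinv : ∀ u : Fin k → ℝ, u ⬝ᵥ (1 : Matrix (Fin k) (Fin k) ℝ) *ᵥ u ≤
      L * (u ⬝ᵥ A⁻¹ *ᵥ u) := by
    intro u
    have := quadForm_inv_le (A := 1) (B := A) PosDef.one hA hL
      (fun u => by simpa using h u) u
    simpa using this
  have h1 := trace_mono Δ hinv
  have h2 := trace_mono (Gᵀ * Δ) hinv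
  have e1 : (Δ * 1 * Δᵀ).trace = ∑ i, ∑ j, Δ i j ^ 2 := by
    rw [Matrix.mul_one, trace_mul_transpose_self]
  have e2 : (Δ * A⁻¹ * Δᵀ).trace = (Gᵀ * Δ * 1 * (Gᵀ * Δ)ᵀ).trace := by
    rw [Matrix.mul_one, trace_mul_comm (Gᵀ * Δ), transpose_mul, transpose_transpose, hΔ, ← hG]
    simp only [Matrix.mul_assoc]
  have e3 : (Gᵀ * Δ * A⁻¹ * (Gᵀ * Δ)ᵀ).trace = (A⁻¹ * Δ * A⁻¹ * Δ).trace := by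
    rw [transpose_mul, transpose_transpose, hΔ, ← Matrix.mul_assoc, trace_mul_comm]
    simp only [← Matrix.mul_assoc, hG]
  rw [e1, e2] at h1
  rw [e3] at h2
  calc _ ≤ _ := h1
    _ ≤ L * (L * (A⁻¹ * Δ * A⁻¹ * Δ).trace) := mul_le_mul_of_nonneg_left h2 hL.le
    _ = _ := by ring

/-- The energy that a perturbation `Δ` of the precision matrix induces in the regression
coefficients is controlled by the signal strength `σ`. -/
lemma energy_mul_inv_mul_le {n p q : ℕ} (x : Fin n → Fin q → ℝ) {A Δ : Matrix (Fin p) (Fin p) ℝ}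
    (Θ : Matrix (Fin q) (Fin p) ℝ) (hA : A.PosDef) (hΔ : Δᵀ = Δ) {l σ : ℝ} (hl : 0 < l)
    (hσ : 0 ≤ σ) (hlow : ∀ u, l * (u ⬝ᵥ u) ≤ u ⬝ᵥ A *ᵥ u)
    (hup : ∀ u, u ⬝ᵥ (Θᵀ * crossMoment x x * Θ) *ᵥ u ≤ σ * (u ⬝ᵥ u)) :
    energy x A (Θ * A⁻¹ * Δ) ≤ σ / l * (A⁻¹ * Δ * A⁻¹ * Δ).trace := by
  obtain ⟨G, hG⟩ := exists_mul_transpose_eq_inv hA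
  have hAs : (A⁻¹)ᵀ = A⁻¹ := isSymm_of_isHermitian hA.inv.isHermitian
  have hAi : A * A⁻¹ = 1 := A.mul_nonsing_inv hA.det_pos.ne'.isUnit
  have hsq : ∀ u : Fin p → ℝ, u ⬝ᵥ (A⁻¹ * A⁻¹) *ᵥ u ≤ l⁻¹ * (u ⬝ᵥ A⁻¹ *ᵥ u) := by
    intro u
    have h1 := hlow (A⁻¹ *ᵥ u)
    rw [mulVec_mulVec, hAi, one_mulVec, dotProduct_comm _ u] at h1
    have h2 : u ⬝ᵥ (A⁻¹ * A⁻¹) *ᵥ u = (A⁻¹ *ᵥ u) ⬝ᵥ (A⁻¹ *ᵥ u) := by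
      rw [← mulVec_mulVec, dotProduct_mulVec, ← mulVec_transpose, hAs]
    rw [h2, le_inv_mul_iff₀ hl]
    exact h1
  have h1 := trace_mono (Gᵀ * Δ * A⁻¹) (C := Θᵀ * crossMoment x x * Θ) (D := 1) (c := σ)
    (fun u => by simpa using hup u)
  have h2 := trace_mono (Gᵀ * Δ) hsq
  have e1 : (Gᵀ * Δ * A⁻¹ * (Θᵀ * crossMoment x x * Θ) * (Gᵀ * Δ * A⁻¹)ᵀ).trace =
      energy x A (Θ * A⁻¹ * Δ) := by
    simp only [energy, transpose_mul, transpose_transpose, hΔ, hAs]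
    rw [← hG, ← Matrix.mul_assoc, ← Matrix.mul_assoc, trace_mul_comm]
    simp only [Matrix.mul_assoc]
  have e2 : (Gᵀ * Δ * A⁻¹ * 1 * (Gᵀ * Δ * A⁻¹)ᵀ).trace =
      (Gᵀ * Δ * (A⁻¹ * A⁻¹) * (Gᵀ * Δ)ᵀ).trace := by
    simp only [transpose_mul, transpose_transpose, hΔ, hAs, Matrix.mul_assoc, Matrix.one_mul]
  have e3 : (Gᵀ * Δ * A⁻¹ * (Gᵀ * Δ)ᵀ).trace = (A⁻¹ * Δ * A⁻¹ * Δ).trace := by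
    rw [transpose_mul, transpose_transpose, hΔ, ← Matrix.mul_assoc, trace_mul_comm]
    simp only [← Matrix.mul_assoc, hG]
  rw [e1, e2] at h1
  rw [e3] at h2
  calc _ ≤ _ := h1
    _ ≤ σ * (l⁻¹ * (A⁻¹ * Δ * A⁻¹ * Δ).trace) := mul_le_mul_of_nonneg_left h2 hσ
    _ = _ := by ring

/-- `B ≤ (1 + ‖B - A‖_F / l) A` when `A ≥ l`. -/
lemma quadForm_le_one_add_mul {k : ℕ} {A B : Matrix (Fin k) (Fin k) ℝ} {l z : ℝ} (hl : 0 < l)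
    (hz : 0 ≤ z) (hlow : ∀ u, l * (u ⬝ᵥ u) ≤ u ⬝ᵥ A *ᵥ u)
    (hBA : ∑ i, ∑ j, (B i j - A i j) ^ 2 ≤ z ^ 2) (u : Fin k → ℝ) :
    u ⬝ᵥ B *ᵥ u ≤ (1 + z / l) * (u ⬝ᵥ A *ᵥ u) := by
  have hcs : (u ⬝ᵥ (B - A) *ᵥ u) ^ 2 ≤ (z * (u ⬝ᵥ u)) ^ 2 := by
    have e1 : u ⬝ᵥ (B - A) *ᵥ u = ∑ e : Fin k × Fin k, (u e.1 * u e.2) * (B e.1 e.2 - A e.1 e.2) := by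
      rw [Fintype.sum_prod_type]
      simp only [dotProduct, mulVec, Matrix.sub_apply, Finset.mul_sum]
      exact Finset.sum_congr rfl fun i _ => Finset.sum_congr rfl fun j _ => by ring
    have e2 : (u ⬝ᵥ u) ^ 2 = ∑ e : Fin k × Fin k, (u e.1 * u e.2) ^ 2 := by
      rw [Fintype.sum_prod_type, sq]
      simp only [dotProduct, Finset.sum_mul_sum]
      exact Finset.sum_congr rfl fun i _ => Finset.sum_congr rfl fun j _ => by ring
    rw [e1, mul_pow, e2, mul_comm (z ^ 2)]
    refine (Finset.sum_mul_sq_le_sq_mul_sq _ _ _).trans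
      (mul_le_mul_of_nonneg_left ?_ (Finset.sum_nonneg fun _ _ => sq_nonneg _))
    rw [Fintype.sum_prod_type]
    exact hBA
  have huu : 0 ≤ u ⬝ᵥ u := by simpa using dotProduct_self_star_nonneg u
  have h1 := abs_le_of_sq_le_sq hcs (mul_nonneg hz huu)
  have h2 : z * (u ⬝ᵥ u) ≤ z / l * (u ⬝ᵥ A *ᵥ u) := by
    rw [div_mul_eq_mul_div, le_div_iff₀ hl, mul_assoc]
    exact mul_le_mul_of_nonneg_left (by linarith [hlow u]) hz
  have h3 : u ⬝ᵥ (B - A) *ᵥ u = u ⬝ᵥ B *ᵥ u - u ⬝ᵥ A *ᵥ u := by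
    rw [sub_mulVec, dotProduct_sub]
  linarith [le_abs_self (u ⬝ᵥ (B - A) *ᵥ u)]

/-! ### Blocks of largest entries -/

lemma exists_largest_entries {ι : Type*} [DecidableEq ι] (v : ι → ℝ) (T : Finset ι) (k : ℕ)
    (hk : k ≤ T.card) :
    ∃ J ⊆ T, J.card = k ∧ ∀ i ∈ J, ∀ j ∈ T \ J, |v j| ≤ |v i| := by
  induction k with
  | zero => exact ⟨∅, by simp, rfl, by simp⟩
  | succ k ih =>
    obtain ⟨J, hJT, hJk, hJ⟩ := ih (by omega)
    have hne : (T \ J).Nonempty := by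
      rw [← Finset.card_pos, Finset.card_sdiff_of_subset hJT]
      omega
    obtain ⟨a, ha, hmax⟩ := Finset.exists_max_image (T \ J) (fun i => |v i|) hne
    rw [Finset.mem_sdiff] at ha
    refine ⟨insert a J, Finset.insert_subset ha.1 hJT, ?_, ?_⟩
    · rw [Finset.card_insert_of_notMem ha.2, hJk]
    · intro i hi j hj
      simp only [Finset.mem_sdiff, Finset.mem_insert, not_or] at hi hj
      have hj' : j ∈ T \ J := Finset.mem_sdiff.2 ⟨hj.1, hj.2.2⟩
      rcases hi with rfl | hi
      · exact hmax j hj'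
      · exact hJ i hi j hj'

/-- Outside its `k` largest entries in `T`, a vector is small in every seminorm that is bounded by
`c` times the Euclidean norm on vectors with at most `k` nonzero entries: split the remainder into
blocks of `k` entries of decreasing size, and compare each block with the preceding one. -/
lemma exists_block_seminorm_le {ι : Type*} [Fintype ι] [DecidableEq ι] (v : ι → ℝ) {k : ℕ}
    (hk : 0 < k) (T : Finset ι) :
    ∃ J ⊆ T, J.card ≤ k ∧ ∀ (N : Seminorm ℝ (ι → ℝ)) (c : ℝ), 0 ≤ c →
      (∀ I ⊆ T, I.card ≤ k → N ((I : Set ι).indicator v) ≤ c * √(∑ i ∈ I, v i ^ 2)) →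
      N (((T \ J : Finset ι) : Set ι).indicator v) * √(k : ℝ) ≤ c * ∑ i ∈ T, |v i| := by
  induction T using Finset.strongInduction with
  | H T ih =>
  by_cases hT : T.card ≤ k
  · refine ⟨T, subset_rfl, hT, fun N c hc _ => ?_⟩
    simp only [sdiff_self, Finset.bot_eq_empty, Finset.coe_empty, Set.indicator_empty]
    have : N (fun _ => 0) = 0 := map_zero N
    rw [this, zero_mul]
    exact mul_nonneg hc (Finset.sum_nonneg fun _ _ => abs_nonneg _)
  obtain ⟨J, hJT, hJk, hJ⟩ := exists_largest_entries v T k (by omega)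
  have hss : T \ J ⊂ T := Finset.sdiff_ssubset hJT (Finset.card_pos.1 (by omega))
  obtain ⟨J', hJ'T, hJ'k, hJ'⟩ := ih (T \ J) hss
  refine ⟨J, hJT, hJk.le, fun N c hc hN => ?_⟩
  have h2 := hJ' N c hc (fun I hI => hN I (hI.trans hss.subset))
  have h1 := hN J' (hJ'T.trans hss.subset) hJ'k
  have hk' : (0 : ℝ) < k := by exact_mod_cast hk
  have hblock : √(∑ i ∈ J', v i ^ 2) * √(k : ℝ) ≤ ∑ i ∈ J, |v i| := by
    have hS : 0 ≤ ∑ i ∈ J, |v i| := Finset.sum_nonneg fun _ _ => abs_nonneg _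
    rw [← Real.sqrt_mul (Finset.sum_nonneg fun _ _ => sq_nonneg _)]
    refine Real.sqrt_le_iff.2 ⟨hS, ?_⟩
    have h3 : ∀ j ∈ J', (k : ℝ) ^ 2 * v j ^ 2 ≤ (∑ i ∈ J, |v i|) ^ 2 := by
      intro j hj
      have h4 : (k : ℝ) * |v j| ≤ ∑ i ∈ J, |v i| := by
        rw [← hJk, ← nsmul_eq_mul]
        exact Finset.card_nsmul_le_sum _ _ _ fun i hi => hJ i hi j (hJ'T hj)
      calc (k : ℝ) ^ 2 * v j ^ 2 = ((k : ℝ) * |v j|) ^ 2 := by rw [mul_pow, sq_abs]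
        _ ≤ _ := by gcongr
    have h5 : (k : ℝ) ^ 2 * ∑ j ∈ J', v j ^ 2 ≤ k * (∑ i ∈ J, |v i|) ^ 2 := by
      rw [Finset.mul_sum]
      refine (Finset.sum_le_card_nsmul _ _ _ h3).trans ?_
      rw [nsmul_eq_mul]
      gcongr
    have : (k : ℝ) * ((∑ j ∈ J', v j ^ 2) * k) ≤ k * (∑ i ∈ J, |v i|) ^ 2 := by linarith
    exact le_of_mul_le_mul_left this hk'
  have hsplit : ((T \ J : Finset ι) : Set ι).indicator v =
      (J' : Set ι).indicator v + (((T \ J) \ J' : Finset ι) : Set ι).indicator v := by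
    ext i
    by_cases hi : i ∈ J'
    · have := hJ'T hi
      simp_all
    · by_cases hi' : i ∈ T \ J <;> simp_all
  rw [hsplit]
  have hsum : ∑ i ∈ T, |v i| = ∑ i ∈ J, |v i| + ∑ i ∈ T \ J, |v i| := by
    rw [add_comm, Finset.sum_sdiff hJT]
  calc N ((J' : Set ι).indicator v + (((T \ J) \ J' : Finset ι) : Set ι).indicator v) * √(k : ℝ)
      ≤ (N ((J' : Set ι).indicator v) + N ((((T \ J) \ J' : Finset ι) : Set ι).indicator v)) *
          √(k : ℝ) := by
        gcongr
        exact map_add_le_add N _ _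
    _ ≤ c * (√(∑ i ∈ J', v i ^ 2) * √(k : ℝ)) + c * ∑ i ∈ T \ J, |v i| := by
        rw [add_mul, ← mul_assoc]
        gcongr
    _ ≤ c * ∑ i ∈ J, |v i| + c * ∑ i ∈ T \ J, |v i| := by gcongr
    _ = _ := by rw [hsum, mul_add]

/-! ### The penalty -/

lemma LP_pos {φ ν : ℝ} (hν : 0 < ν) : 0 < LP φ ν := by unfold LP; positivity

lemma LP_le_exp_mul {φ φ' ν ν' : ℝ} (hν : 0 < ν) (hν' : ν ≤ ν') :
    LP φ ν' ≤ Real.exp (|φ - φ'| / ν) * LP φ' ν' := by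
  have hν'0 := hν.trans_le hν'
  unfold LP
  rw [mul_left_comm, ← Real.exp_add]
  gcongr
  have h1 : |φ - φ'| / ν' ≤ |φ - φ'| / ν := by gcongr
  have h2 : -|φ| / ν' ≤ (|φ - φ'| + -|φ'|) / ν' := by
    gcongr
    have := abs_sub_abs_le_abs_sub φ' φ
    rw [abs_sub_comm] at this
    linarith
  rw [add_div] at h2
  linarith

lemma LP_le_exp_neg_mul {φ ν ν' : ℝ} (hν : 0 < ν) (hν' : ν ≤ ν') :
    LP φ ν ≤ Real.exp (-|φ| / ν') * LP 0 ν := by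
  unfold LP
  rw [mul_left_comm, ← Real.exp_add]
  gcongr
  simp only [abs_zero, neg_zero, zero_div, add_zero, neg_div]
  gcongr

lemma ssl_pos {h : Hyper} (hh : h.Valid) (φ : ℝ) : 0 < ssl h φ := by
  have h0 := LP_pos (φ := φ) hh.ν0_pos
  have h1 := LP_pos (φ := φ) (hh.ν0_pos.trans_le hh.ν_le)
  obtain ⟨ha, hb⟩ := hh.η_mem
  unfold ssl
  rcases hb.lt_or_eq with hb | hb
  · have := mul_pos (sub_pos.2 hb) h0
    nlinarith [mul_nonneg ha h1.le]
  · rw [hb]; simpa using h1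

lemma ssl_le_exp_mul {h : Hyper} (hh : h.Valid) (φ φ' : ℝ) :
    ssl h φ ≤ Real.exp (|φ - φ'| / h.ν0) * ssl h φ' := by
  have h0 := LP_le_exp_mul (φ := φ) (φ' := φ') hh.ν0_pos le_rfl
  have h1 := LP_le_exp_mul (φ := φ) (φ' := φ') hh.ν0_pos hh.ν_le
  unfold ssl
  have := mul_le_mul_of_nonneg_left h1 hh.η_mem.1
  have := mul_le_mul_of_nonneg_left h0 (sub_nonneg.2 hh.η_mem.2)
  linarith

lemma ssl_le_exp_neg_mul {h : Hyper} (hh : h.Valid) (φ : ℝ) :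
    ssl h φ ≤ Real.exp (-|φ| / h.ν1) * ssl h 0 := by
  have h0 := LP_le_exp_neg_mul (φ := φ) hh.ν0_pos hh.ν_le
  have h1 := LP_le_exp_neg_mul (φ := φ) (hh.ν0_pos.trans_le hh.ν_le) le_rfl
  unfold ssl
  have := mul_le_mul_of_nonneg_left h1 hh.η_mem.1
  have := mul_le_mul_of_nonneg_left h0 (sub_nonneg.2 hh.η_mem.2)
  linarith

/-- The prior density of one row of `Θ`. -/
noncomputable def rowPrior {p : ℕ} (h : Hyper) (θ : Fin p → ℝ) : ℝ :=
  h.ρ * ∏ j, ssl h (θ j) + (1 - h.ρ) * ∏ j, LP (θ j) h.ν0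

lemma rowPrior_pos {p : ℕ} {h : Hyper} (hh : h.Valid) (θ : Fin p → ℝ) : 0 < rowPrior h θ := by
  have h0 : 0 < ∏ j, LP (θ j) h.ν0 := Finset.prod_pos fun _ _ => LP_pos hh.ν0_pos
  have h1 : 0 < ∏ j, ssl h (θ j) := Finset.prod_pos fun _ _ => ssl_pos hh _
  obtain ⟨ha, hb⟩ := hh.ρ_mem
  unfold rowPrior
  rcases hb.lt_or_eq with hb | hb
  · have := mul_pos (sub_pos.2 hb) h0
    nlinarith [mul_nonneg ha h1.le]
  · rw [hb]; simpa using h1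

lemma log_rowPrior_sub_le {p : ℕ} {h : Hyper} (hh : h.Valid) {θ θ' : Fin p → ℝ} {w : Fin p → ℝ}
    (hs : ∀ j, ssl h (θ j) ≤ Real.exp (w j) * ssl h (θ' j))
    (hl : ∀ j, LP (θ j) h.ν0 ≤ Real.exp (w j) * LP (θ' j) h.ν0) :
    Real.log (rowPrior h θ) - Real.log (rowPrior h θ') ≤ ∑ j, w j := by
  have h1 : ∏ j, ssl h (θ j) ≤ Real.exp (∑ j, w j) * ∏ j, ssl h (θ' j) := by
    rw [Real.exp_sum, ← Finset.prod_mul_distrib]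
    exact Finset.prod_le_prod (fun j _ => (ssl_pos hh _).le) fun j _ => hs j
  have h2 : ∏ j, LP (θ j) h.ν0 ≤ Real.exp (∑ j, w j) * ∏ j, LP (θ' j) h.ν0 := by
    rw [Real.exp_sum, ← Finset.prod_mul_distrib]
    exact Finset.prod_le_prod (fun j _ => (LP_pos hh.ν0_pos).le) fun j _ => hl j
  have h3 : rowPrior h θ ≤ Real.exp (∑ j, w j) * rowPrior h θ' := by
    unfold rowPrior
    have := mul_le_mul_of_nonneg_left h1 hh.ρ_mem.1
    have := mul_le_mul_of_nonneg_left h2 (sub_nonneg.2 hh.ρ_mem.2)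
    linarith
  have h4 := Real.log_le_log (rowPrior_pos hh θ) h3
  rw [Real.log_mul (Real.exp_pos _).ne' (rowPrior_pos hh θ').ne', Real.log_exp] at h4
  linarith

lemma log_priorΘ_sub_le {p q : ℕ} {h : Hyper} (hh : h.Valid) (t : Truth p q)
    (Θ : Matrix (Fin q) (Fin p) ℝ) :
    Real.log (priorΘ h Θ) - Real.log (priorΘ h t.Θ) ≤
      (∑ e ∈ t.SΘrow, |Θ e.1 e.2 - t.Θ e.1 e.2|) / h.ν0 -
        (∑ e ∈ t.SΘrowᶜ, |Θ e.1 e.2 - t.Θ e.1 e.2|) / h.ν1 := by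
  have hlog : ∀ Ψ : Matrix (Fin q) (Fin p) ℝ,
      Real.log (priorΘ h Ψ) = ∑ i, Real.log (rowPrior h (Ψ i)) := fun Ψ =>
    Real.log_prod fun i _ => (rowPrior_pos hh (Ψ i)).ne'
  set w : Fin q × Fin p → ℝ := fun e =>
    if t.Θ e.1 ≠ 0 then |Θ e.1 e.2 - t.Θ e.1 e.2| / h.ν0
      else -(|Θ e.1 e.2 - t.Θ e.1 e.2| / h.ν1) with hw
  have hrhs : (∑ e ∈ t.SΘrow, |Θ e.1 e.2 - t.Θ e.1 e.2|) / h.ν0 -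
        (∑ e ∈ t.SΘrowᶜ, |Θ e.1 e.2 - t.Θ e.1 e.2|) / h.ν1 = ∑ e, w e := by
    rw [← Finset.sum_add_sum_compl t.SΘrow w, Finset.sum_div, Finset.sum_div, sub_eq_add_neg,
      ← Finset.sum_neg_distrib]
    congr 1
    · refine Finset.sum_congr rfl fun e he => ?_
      have : t.Θ e.1 ≠ 0 := by simpa [Truth.SΘrow] using he
      simp [hw, this]
    · refine Finset.sum_congr rfl fun e he => ?_
      have : t.Θ e.1 = 0 := by simpa [Truth.SΘrow] using he
      simp [hw, this]
  rw [hrhs, hlog, hlog, ← Finset.sum_sub_distrib, Fintype.sum_prod_type]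
  refine Finset.sum_le_sum fun i _ => ?_
  by_cases hi : t.Θ i = 0
  · refine log_rowPrior_sub_le hh (fun j => ?_) fun j => ?_
    · simpa [hw, hi, neg_div] using ssl_le_exp_neg_mul hh (Θ i j)
    · simpa [hw, hi, neg_div] using LP_le_exp_neg_mul (φ := Θ i j) hh.ν0_pos hh.ν_le
  · refine log_rowPrior_sub_le hh (fun j => ?_) fun j => ?_
    · simpa [hw, hi] using ssl_le_exp_mul hh (Θ i j) (t.Θ i j)
    · simpa [hw, hi] using LP_le_exp_mul (φ := Θ i j) (φ' := t.Θ i j) hh.ν0_pos le_rfl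

lemma two_mul_sum_Ioi {p : ℕ} (f : Fin p → Fin p → ℝ) (hf : ∀ i j, f i j = f j i) :
    2 * ∑ i, ∑ j ∈ Finset.Ioi i, f i j = ∑ i, ∑ j, f i j - ∑ i, f i i := by
  have h1 : ∀ i, ∑ j ∈ Finset.Ioi i, f i j = ∑ j, if i < j then f i j else 0 := by
    intro i
    rw [← Finset.sum_filter]
    congr 1
    ext j
    simp
  have h2 : ∑ i, ∑ j, (if i < j then f i j else 0) = ∑ i, ∑ j, if j < i then f i j else 0 := by
    rw [Finset.sum_comm]
    refine Finset.sum_congr rfl fun i _ => Finset.sum_congr rfl fun j _ => ?_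
    rw [hf]
  have h3 : ∑ i, f i i = ∑ i, ∑ j, if i = j then f i j else 0 := by simp
  have h4 : ∑ i, ∑ j, f i j = ∑ i, ∑ j, (if i < j then f i j else 0) +
      ∑ i, ∑ j, (if j < i then f i j else 0) + ∑ i, ∑ j, if i = j then f i j else 0 := by
    simp only [← Finset.sum_add_distrib]
    refine Finset.sum_congr rfl fun i _ => Finset.sum_congr rfl fun j _ => ?_
    rcases lt_trichotomy i j with hij | rfl | hij
    · simp [hij, hij.ne, hij.not_gt]
    · simp
    · simp [hij, hij.ne', hij.not_gt]
  simp only [h1]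
  rw [h4, h3, ← h2]
  ring

/-- The prior on `Λ` sees each off-diagonal position once, while the sums on the right see it
twice; this is the factor `2`. -/
lemma log_priorΛ_sub_le {p q : ℕ} {h : Hyper} (hh : h.Valid) {t : Truth p q} (ht : t.Valid)
    {Λ : Matrix (Fin p) (Fin p) ℝ} (hΛ : Λᵀ = Λ) :
    Real.log (priorΛ h Λ) - Real.log (priorΛ h t.Λ) ≤
      (∑ e ∈ t.SΛ, |Λ e.1 e.2 - t.Λ e.1 e.2|) / (2 * h.ν0) -
        (∑ e ∈ t.SΛᶜ, |Λ e.1 e.2 - t.Λ e.1 e.2|) / (2 * h.ν1) := by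
  have hlog : ∀ Ψ : Matrix (Fin p) (Fin p) ℝ,
      Real.log (priorΛ h Ψ) = ∑ i, ∑ j ∈ Finset.Ioi i, Real.log (ssl h (Ψ i j)) := fun Ψ => by
    unfold priorΛ
    refine (Real.log_prod fun i _ => (Finset.prod_pos fun j _ => ssl_pos hh _).ne').trans ?_
    exact Finset.sum_congr rfl fun i _ => Real.log_prod fun j _ => (ssl_pos hh _).ne'
  have hsymm := isSymm_of_isHermitian ht.Λ_pos.isHermitian
  have hΛ' : ∀ i j, Λ i j = Λ j i := fun i j => congrFun (congrFun hΛ.symm i) j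
  have ht' : ∀ i j, t.Λ i j = t.Λ j i := fun i j => congrFun (congrFun hsymm.symm i) j
  set w : Fin p → Fin p → ℝ := fun i j =>
    if t.Λ i j ≠ 0 then |Λ i j - t.Λ i j| / h.ν0 else -(|Λ i j - t.Λ i j| / h.ν1) with hw
  have hrhs : (∑ e ∈ t.SΛ, |Λ e.1 e.2 - t.Λ e.1 e.2|) / (2 * h.ν0) -
        (∑ e ∈ t.SΛᶜ, |Λ e.1 e.2 - t.Λ e.1 e.2|) / (2 * h.ν1) = (∑ i, ∑ j, w i j) / 2 := by
    rw [← Fintype.sum_prod_type', ← Finset.sum_add_sum_compl t.SΛ, Finset.sum_div, Finset.sum_div,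
      add_div, Finset.sum_div, Finset.sum_div, sub_eq_add_neg, ← Finset.sum_neg_distrib]
    congr 1
    · refine Finset.sum_congr rfl fun e he => ?_
      have : t.Λ e.1 e.2 ≠ 0 := by simpa [Truth.SΛ] using he
      simp only [hw, this, ne_eq, not_false_eq_true, if_true]
      ring
    · refine Finset.sum_congr rfl fun e he => ?_
      have : t.Λ e.1 e.2 = 0 := by simpa [Truth.SΛ] using he
      simp only [hw, this, ne_eq, not_true_eq_false, if_false]
      ring
  have hdiag : 0 ≤ ∑ i, w i i := Finset.sum_nonneg fun i _ => by
    have : t.Λ i i ≠ 0 := ht.Λ_pos.diag_pos.ne'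
    simp only [hw, this, ne_eq, not_false_eq_true, if_true]
    have := hh.ν0_pos
    positivity
  have hhalf := two_mul_sum_Ioi w fun i j => by simp only [hw, hΛ' i j, ht' i j]
  have hle : Real.log (priorΛ h Λ) - Real.log (priorΛ h t.Λ) ≤
      ∑ i, ∑ j ∈ Finset.Ioi i, w i j := by
    rw [hlog, hlog]
    simp only [← Finset.sum_sub_distrib]
    refine Finset.sum_le_sum fun i _ => Finset.sum_le_sum fun j _ => ?_
    have key : ssl h (Λ i j) ≤ Real.exp (w i j) * ssl h (t.Λ i j) := by
      by_cases hij : t.Λ i j = 0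
      · simpa [hw, hij, neg_div] using ssl_le_exp_neg_mul hh (Λ i j)
      · simpa [hw, hij] using ssl_le_exp_mul hh (Λ i j) (t.Λ i j)
    have h4 := Real.log_le_log (ssl_pos hh _) key
    rw [Real.log_mul (Real.exp_pos _).ne' (ssl_pos hh _).ne', Real.log_exp] at h4
    linarith
  rw [hrhs]
  linarith

/-! ### The gradient of the log-likelihood -/

lemma sum_mul_eq_trace {a b : Type*} [Fintype a] [Fintype b] (P : Matrix b a ℝ)
    (V : Matrix a b ℝ) : ∑ i, ∑ j, P j i * V i j = (P * V).trace := by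
  simp only [trace, diag_apply, mul_apply]
  rw [Finset.sum_comm]

lemma trace_mul_single_one {a b : Type*} [Fintype a] [Fintype b] [DecidableEq a] [DecidableEq b]
    (P : Matrix b a ℝ) (i : a) (j : b) : (P * Matrix.single i j (1 : ℝ)).trace = P j i := by
  rw [trace_mul_single]
  simp

lemma det_one_add_smul_mul_single {k : ℕ} (P : Matrix (Fin k) (Fin k) ℝ) (i j : Fin k) (s : ℝ) :
    (1 + s • (P * Matrix.single i j 1)).det = 1 + s * P j i := by
  have h1 : s • (P * Matrix.single i j (1 : ℝ)) =
      (s • (P * Matrix.single i () (1 : ℝ))) * Matrix.single () j (1 : ℝ) := by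
    rw [Matrix.smul_mul, Matrix.mul_assoc, single_mul_single_same, one_mul]
  rw [h1, det_one_add_mul_comm, det_unique, Matrix.mul_smul, ← Matrix.mul_assoc,
    single_mul_mul_single]
  simp

/-- The determinant and the inverse (Sherman–Morrison formula) of a matrix of which one entry is
perturbed. -/
lemma det_and_inv_add_smul_single {k : ℕ} {A : Matrix (Fin k) (Fin k) ℝ} (hA : A.det ≠ 0)
    (i j : Fin k) {s : ℝ} (hs : 1 + s * A⁻¹ j i ≠ 0) :
    (A + s • Matrix.single i j 1).det = A.det * (1 + s * A⁻¹ j i) ∧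
    (A + s • Matrix.single i j 1)⁻¹ =
      A⁻¹ - (s / (1 + s * A⁻¹ j i)) • (A⁻¹ * Matrix.single i j 1 * A⁻¹) := by
  have hAi : A * A⁻¹ = 1 := A.mul_nonsing_inv hA.isUnit
  set E : Matrix (Fin k) (Fin k) ℝ := Matrix.single i j 1 with hE
  constructor
  · rw [← det_one_add_smul_mul_single A⁻¹ i j s, ← det_mul, Matrix.mul_add, Matrix.mul_one,
      Matrix.mul_smul, ← Matrix.mul_assoc, hAi, Matrix.one_mul]
  · refine inv_eq_right_inv ?_
    have hEAE : E * A⁻¹ * E = A⁻¹ j i • E := by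
      rw [hE, single_mul_mul_single, smul_single]
      simp
    have h1 : A * (A⁻¹ * E * A⁻¹) = E * A⁻¹ := by
      rw [← Matrix.mul_assoc, ← Matrix.mul_assoc, hAi, Matrix.one_mul]
    have h2 : E * (A⁻¹ * E * A⁻¹) = A⁻¹ j i • (E * A⁻¹) := by
      rw [← Matrix.mul_assoc, ← Matrix.mul_assoc, hEAE, Matrix.smul_mul]
    rw [Matrix.add_mul, Matrix.mul_sub, Matrix.mul_sub, Matrix.mul_smul, Matrix.mul_smul,
      Matrix.smul_mul, Matrix.smul_mul, h1, h2, hAi, smul_smul, smul_smul, sub_add, sub_eq_self,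
      sub_sub_eq_add_sub, ← add_smul, ← sub_smul]
    have : s / (1 + s * A⁻¹ j i) + s / (1 + s * A⁻¹ j i) * s * A⁻¹ j i - s = 0 := by
      field_simp
      ring
    rw [this, zero_smul]

lemma gradΘ_eq {n p q : ℕ} (x : Fin n → Fin q → ℝ) (y : Fin n → Fin p → ℝ)
    (Θ : Matrix (Fin q) (Fin p) ℝ) {A : Matrix (Fin p) (Fin p) ℝ} (hA : A.PosDef)
    (i : Fin q) (j : Fin p) :
    gradΘ x y Θ A i j =
      (-(n : ℝ) • ((crossMoment x y)ᵀ + A⁻¹ * Θᵀ * crossMoment x x)) j i := by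
  have hAs : (A⁻¹)ᵀ = A⁻¹ := isSymm_of_isHermitian hA.inv.isHermitian
  have hS := isSymm_crossMoment x
  set S := crossMoment x x with hSd
  set E : Matrix (Fin q) (Fin p) ℝ := Matrix.single i j 1 with hE
  set c := ((crossMoment x y)ᵀ * E).trace with hc
  set d := (A⁻¹ * Θᵀ * S * E).trace with hd
  have hd' : (A⁻¹ * Eᵀ * S * Θ).trace = d := by
    rw [hd, ← trace_transpose]
    simp only [transpose_mul, transpose_transpose, hS, hAs]
    rw [← Matrix.mul_assoc, ← Matrix.mul_assoc, trace_mul_comm]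
    simp only [Matrix.mul_assoc]
  have hfun : (fun s : ℝ => logLik x y (Θ + s • E) A) = fun s : ℝ => logLik x y Θ A +
      (n : ℝ) / 2 * (-(2 * c + 2 * d) * s - (A⁻¹ * Eᵀ * S * E).trace * s ^ 2) := by
    funext s
    simp only [logLik, ← hSd, Matrix.mul_add, Matrix.add_mul, transpose_add, transpose_smul,
      Matrix.mul_smul, Matrix.smul_mul, trace_add, trace_smul, smul_add, smul_eq_mul, hd', ← hc,
      ← hd]
    ring
  have hder : HasDerivAt (fun s : ℝ => logLik x y (Θ + s • E) A)
      ((n : ℝ) / 2 * (-(2 * c + 2 * d) * 1 -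
        (A⁻¹ * Eᵀ * S * E).trace * ((2 : ℕ) * (0 : ℝ) ^ (2 - 1) * 1))) 0 := by
    rw [hfun]
    exact ((((hasDerivAt_id (0 : ℝ)).const_mul _).sub
      (((hasDerivAt_id (0 : ℝ)).pow 2).const_mul _)).const_mul _).const_add _
  rw [gradΘ, ← hE, hder.deriv, ← trace_mul_single_one (-(n : ℝ) • _) i j, ← hE, Matrix.smul_mul,
    Matrix.add_mul, trace_smul, trace_add, ← hc, ← hd, smul_eq_mul]
  norm_num
  ring

lemma gradΛ_eq {n p q : ℕ} (x : Fin n → Fin q → ℝ) (y : Fin n → Fin p → ℝ)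
    (Θ : Matrix (Fin q) (Fin p) ℝ) {A : Matrix (Fin p) (Fin p) ℝ} (hA : A.PosDef) (i j : Fin p) :
    gradΛ x y Θ A i j = (((n : ℝ) / 2) •
      (A⁻¹ - crossMoment y y + A⁻¹ * (Θᵀ * crossMoment x x * Θ) * A⁻¹)) j i := by
  set P := Θᵀ * crossMoment x x * Θ with hP
  set E : Matrix (Fin p) (Fin p) ℝ := Matrix.single i j 1 with hE
  set a := A⁻¹ j i with ha
  set d := (A⁻¹ * E * A⁻¹ * P).trace with hd
  have hd' : d = (A⁻¹ * P * A⁻¹) j i := by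
    rw [hd, ← trace_mul_single_one (A⁻¹ * P * A⁻¹), ← hE, Matrix.mul_assoc (A⁻¹ * E),
      trace_mul_comm]
    simp only [Matrix.mul_assoc]
  have hne : ∀ᶠ s : ℝ in 𝓝 0, 1 + s * a ≠ 0 := by
    have : ContinuousAt (fun s : ℝ => 1 + s * a) 0 := by fun_prop
    exact this.eventually_ne (by simp)
  have hfun : (fun s : ℝ => logLik x y Θ (A + s • E)) =ᶠ[𝓝 0] fun s : ℝ =>
      (n : ℝ) / 2 * (Real.log (1 + s * a) + (d * (s / (1 + s * a)) - crossMoment y y j i * s)) +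
        logLik x y Θ A := by
    filter_upwards [hne] with s hs
    obtain ⟨h1, h2⟩ := det_and_inv_add_smul_single hA.det_pos.ne' i j hs
    rw [← hE] at h1 h2
    rw [logLik, h1, h2, Real.log_mul hA.det_pos.ne' hs, logLik]
    have e1 : ∀ B : Matrix (Fin p) (Fin p) ℝ, B * Θᵀ * crossMoment x x * Θ = B * P := by
      intro B
      simp only [hP, Matrix.mul_assoc]
    simp only [e1, Matrix.mul_add, Matrix.mul_smul, Matrix.sub_mul, Matrix.smul_mul, trace_add,
      trace_sub, trace_smul, smul_eq_mul, ← hd]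
    rw [hE, trace_mul_single_one]
    ring
  have hlin : HasDerivAt (fun s : ℝ => 1 + s * a) (1 * a) 0 :=
    ((hasDerivAt_id (0 : ℝ)).mul_const a).const_add 1
  have h0 : (1 : ℝ) + 0 * a ≠ 0 := by simp
  have hder := (((hlin.log h0).add ((((hasDerivAt_id (0 : ℝ)).div hlin h0).const_mul d).sub
    ((hasDerivAt_id (0 : ℝ)).const_mul (crossMoment y y j i)))).const_mul ((n : ℝ) / 2)).add_const
      (logLik x y Θ A)
  have hder' := hder.congr_of_eventuallyEq (f₁ := fun s : ℝ => logLik x y Θ (A + s • E)) hfun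
  rw [gradΛ, ← hE, hder'.deriv]
  simp only [Matrix.smul_apply, Matrix.add_apply, Matrix.sub_apply, smul_eq_mul, ← hd', ← ha,
    id_eq, zero_mul, add_zero, one_mul, mul_one, sub_zero, one_pow, div_one]
  ring

/-! ### The exact second-order expansion -/

/-- The directional derivative of the log-likelihood at `(Θ, A)`, in the direction `(U, V)`. -/
noncomputable def dirDeriv {n p q : ℕ} (x : Fin n → Fin q → ℝ) (y : Fin n → Fin p → ℝ)
    (Θ : Matrix (Fin q) (Fin p) ℝ) (A : Matrix (Fin p) (Fin p) ℝ)
    (U : Matrix (Fin q) (Fin p) ℝ) (V : Matrix (Fin p) (Fin p) ℝ) : ℝ :=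
  ∑ i, ∑ j, gradΘ x y Θ A i j * U i j + ∑ i, ∑ j, gradΛ x y Θ A i j * V i j

/-- The remainder of the linear expansion of the log-likelihood is minus `n / 2` times the sum of
the log-determinant divergence and the energy of `Θ' - Θ A⁻¹ B`. This is an identity, since
`tr(A⁻¹ Θᵀ S Θ)` is homogeneous of degree one in `(Θ, A)`. -/
lemma logLik_sub_eq {n p q : ℕ} (x : Fin n → Fin q → ℝ) (y : Fin n → Fin p → ℝ)
    (Θ Θ' : Matrix (Fin q) (Fin p) ℝ) {A B : Matrix (Fin p) (Fin p) ℝ} (hA : A.PosDef)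
    (hB : B.PosDef) :
    logLik x y Θ' B - logLik x y Θ A = dirDeriv x y Θ A (Θ' - Θ) (B - A) -
      (n : ℝ) / 2 * ((Real.log A.det - Real.log B.det + (A⁻¹ * (B - A)).trace) +
        energy x B ((Θ' - Θ) - Θ * A⁻¹ * (B - A))) := by
  have hAs : (A⁻¹)ᵀ = A⁻¹ := isSymm_of_isHermitian hA.inv.isHermitian
  have hBs : Bᵀ = B := isSymm_of_isHermitian hB.isHermitian
  have hBsi : (B⁻¹)ᵀ = B⁻¹ := isSymm_of_isHermitian hB.inv.isHermitian
  have hS := isSymm_crossMoment x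
  have hAi : A⁻¹ * A = 1 := A.nonsing_inv_mul hA.det_pos.ne'.isUnit
  have hBi : B⁻¹ * B = 1 := B.nonsing_inv_mul hB.det_pos.ne'.isUnit
  have hd : dirDeriv x y Θ A (Θ' - Θ) (B - A) =
      (-(n : ℝ) • ((crossMoment x y)ᵀ + A⁻¹ * Θᵀ * crossMoment x x) * (Θ' - Θ)).trace +
      (((n : ℝ) / 2) • (A⁻¹ - crossMoment y y + A⁻¹ * (Θᵀ * crossMoment x x * Θ) * A⁻¹) *
        (B - A)).trace := by
    rw [← sum_mul_eq_trace, ← sum_mul_eq_trace, dirDeriv]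
    simp only [gradΘ_eq x y Θ hA, gradΛ_eq x y Θ hA]
  have hW : (Θ' - Θ) - Θ * A⁻¹ * (B - A) = Θ' - Θ * A⁻¹ * B := by
    rw [Matrix.mul_sub, Matrix.mul_assoc Θ A⁻¹ A, hAi, Matrix.mul_one]
    abel
  set S := crossMoment x x with hSd
  -- the energy, expanded
  have e1 : energy x B (Θ' - Θ * A⁻¹ * B) = (B⁻¹ * Θ'ᵀ * S * Θ').trace -
      2 * (A⁻¹ * Θᵀ * S * Θ').trace + (A⁻¹ * (Θᵀ * S * Θ) * A⁻¹ * B).trace := by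
    have t1 : (B⁻¹ * (B * (A⁻¹ * Θᵀ)) * S * Θ').trace = (A⁻¹ * Θᵀ * S * Θ').trace := by
      rw [← Matrix.mul_assoc B⁻¹, hBi, Matrix.one_mul]
    have t2 : (B⁻¹ * Θ'ᵀ * S * (Θ * A⁻¹ * B)).trace = (A⁻¹ * Θᵀ * S * Θ').trace := by
      rw [← t1, ← trace_transpose]
      simp only [transpose_mul, transpose_transpose, hS, hAs, hBs, hBsi]
      rw [← Matrix.mul_assoc, ← Matrix.mul_assoc, trace_mul_comm]
      simp only [Matrix.mul_assoc]
    have t3 : (B⁻¹ * (B * (A⁻¹ * Θᵀ)) * S * (Θ * A⁻¹ * B)).trace =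
        (A⁻¹ * (Θᵀ * S * Θ) * A⁻¹ * B).trace := by
      rw [← Matrix.mul_assoc B⁻¹, hBi, Matrix.one_mul]
      simp only [Matrix.mul_assoc]
    rw [energy, ← hSd, transpose_sub, transpose_mul, transpose_mul, hAs, hBs]
    simp only [Matrix.mul_sub, Matrix.sub_mul, trace_sub]
    rw [t1, t2, t3]
    ring
  have e2 : (A⁻¹ * (Θᵀ * S * Θ) * A⁻¹ * A).trace = (A⁻¹ * Θᵀ * S * Θ).trace := by
    rw [Matrix.mul_assoc _ A⁻¹ A, hAi, Matrix.mul_one]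
    simp only [Matrix.mul_assoc]
  rw [hd, hW, e1]
  simp only [logLik, ← hSd, Matrix.smul_mul, Matrix.mul_sub, Matrix.sub_mul, Matrix.add_mul,
    trace_smul, trace_add, trace_sub, smul_eq_mul, e2]
  ring

/-- Hölder's inequality for the pairing of the gradient with a direction. -/
lemma dirDeriv_le {n p q : ℕ} (x : Fin n → Fin q → ℝ) (y : Fin n → Fin p → ℝ)
    (Θ : Matrix (Fin q) (Fin p) ℝ) (A : Matrix (Fin p) (Fin p) ℝ)
    (U : Matrix (Fin q) (Fin p) ℝ) (V : Matrix (Fin p) (Fin p) ℝ) :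
    dirDeriv x y Θ A U V ≤ gradSup x y Θ A *
      (∑ e : Fin q × Fin p, |U e.1 e.2| + ∑ e : Fin p × Fin p, |V e.1 e.2|) := by
  have h1 : ∀ e : Fin q × Fin p, |gradΘ x y Θ A e.1 e.2| ≤ gradSup x y Θ A := fun e =>
    (le_ciSup (f := fun e : Fin q × Fin p => |gradΘ x y Θ A e.1 e.2|)
      (Set.finite_range _).bddAbove e).trans (le_max_left _ _)
  have h2 : ∀ e : Fin p × Fin p, |gradΛ x y Θ A e.1 e.2| ≤ gradSup x y Θ A := fun e =>
    (le_ciSup (f := fun e : Fin p × Fin p => |gradΛ x y Θ A e.1 e.2|)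
      (Set.finite_range _).bddAbove e).trans (le_max_right _ _)
  rw [dirDeriv, ← Fintype.sum_prod_type' (f := fun i j => gradΘ x y Θ A i j * U i j),
    ← Fintype.sum_prod_type' (f := fun i j => gradΛ x y Θ A i j * V i j), mul_add,
    Finset.mul_sum, Finset.mul_sum]
  refine add_le_add (Finset.sum_le_sum fun e _ => ?_) (Finset.sum_le_sum fun e _ => ?_)
  · refine (le_abs_self _).trans ?_
    rw [abs_mul]
    exact mul_le_mul_of_nonneg_right (h1 e) (abs_nonneg _)
  · refine (le_abs_self _).trans ?_
    rw [abs_mul]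
    exact mul_le_mul_of_nonneg_right (h2 e) (abs_nonneg _)

/-! ### Constants of the model -/

section Constants

variable {p q : ℕ} {t : Truth p q}

lemma lamMax_Λ_pos (hp : 0 < p) (ht : t.Valid) : 0 < lamMax t.Λ :=
  (lamMin_pos hp ht.Λ_pos).trans_le (lamMin_le_lamMax hp ht.Λ_pos.isHermitian)

lemma lamMax_Cov_pos (hq : 0 < q) (ht : t.Valid) : 0 < lamMax t.Cov :=
  (lamMin_pos hq ht.Cov_pos).trans_le (lamMin_le_lamMax hq ht.Cov_pos.isHermitian)

lemma rho1_pos (hp : 0 < p) (hq : 0 < q) (ht : t.Valid) : 0 < t.rho1 := by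
  have := inv_pos.2 (lamMax_Λ_pos hp ht)
  have := lamMin_pos hq ht.Cov_pos
  unfold Truth.rho1
  positivity

lemma rho1_le_inv : t.rho1 ≤ 0.5 * (lamMax t.Λ)⁻¹ :=
  mul_le_mul_of_nonneg_left (min_le_left _ _) (by norm_num)

lemma rho1_le_lamMin : t.rho1 ≤ 0.5 * lamMin t.Cov :=
  mul_le_mul_of_nonneg_left (min_le_right _ _) (by norm_num)

lemma rho1_le_rho2 (hq : 0 < q) (ht : t.Valid) : t.rho1 ≤ t.rho2 := by
  have h1 := rho1_le_lamMin (t := t)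
  have h2 := lamMin_le_lamMax hq ht.Cov_pos.isHermitian
  have h3 := lamMax_Cov_pos hq ht
  unfold Truth.rho2
  linarith

lemma signal_pos (ht : t.Valid) : 0 < t.signal := by
  obtain ⟨i, j, hij⟩ : ∃ i j, t.Θ i j ≠ 0 := by
    by_contra! h
    exact ht.Θ_ne (Matrix.ext h)
  have hH : (t.Θᵀ * t.Cov * t.Θ).IsHermitian := by
    have := isHermitian_conjTranspose_mul_mul t.Θ ht.Cov_pos.isHermitian
    rwa [conjTranspose_eq_transpose_of_trivial] at this
  have h1 := le_lamMax_mul hH (Pi.single j 1)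
  have h2 : t.Θ *ᵥ Pi.single j 1 ≠ 0 := by
    intro h0
    have := congrFun h0 i
    simp at this
    exact hij this
  have h3 := quadForm_pos ht.Cov_pos h2
  have h4 : (Pi.single j 1 : Fin p → ℝ) ⬝ᵥ (t.Θᵀ * t.Cov * t.Θ) *ᵥ Pi.single j 1 =
      (t.Θ *ᵥ Pi.single j 1) ⬝ᵥ t.Cov *ᵥ (t.Θ *ᵥ Pi.single j 1) := by
    rw [← mulVec_mulVec, ← mulVec_mulVec, dotProduct_mulVec, vecMul_transpose]
  rw [h4] at h1
  have h5 : (Pi.single j 1 : Fin p → ℝ) ⬝ᵥ Pi.single j 1 = 1 := by simp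
  rw [h5, mul_one] at h1
  exact h3.trans_le h1

lemma posDef_three_smul (ht : t.Valid) : ((3 : ℝ) • t.Λ).PosDef :=
  ht.Λ_pos.smul (by norm_num)

lemma beta0_pos (hp : 0 < p) (hq : 0 < q) (ht : t.Valid) : 0 < t.beta0 := by
  have h1 := rho1_pos hp hq ht
  have h2 := lamMax_Λ_pos hp ht
  have h3 := lamMin_pos hp (posDef_three_smul ht)
  have h4 := signal_pos ht
  unfold Truth.beta0
  positivity

lemma Srow_card : t.Srow.card = t.SΘrow.card + t.SΛ.card := Finset.card_disjSum _ _

lemma Srow_card_pos (hp : 0 < p) (ht : t.Valid) : 0 < t.Srow.card := by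
  have : (⟨0, hp⟩, ⟨0, hp⟩) ∈ t.SΛ := by
    simpa [Truth.SΛ] using (ht.Λ_pos.diag_pos (i := ⟨0, hp⟩)).ne'
  have := Finset.card_pos.2 ⟨_, this⟩
  rw [Srow_card]
  omega

lemma log_add_pos (hp : 0 < p) (hq : 0 < q) : 0 < Real.log ((p : ℝ) + q) := by
  refine Real.log_pos ?_
  have h1 : (1 : ℝ) ≤ p := by exact_mod_cast hp
  have h2 : (1 : ℝ) ≤ q := by exact_mod_cast hq
  linarith

lemma one_le_alpha {h : Hyper} (hh : h.Valid) : 1 ≤ h.alpha := by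
  have h0 := hh.ν0_pos
  have h1 := h0.trans_le hh.ν_le
  have : 0 ≤ 2 * h.ν1 / h.ν0 := by positivity
  unfold Hyper.alpha
  linarith

end Constants

/-! ### Restricted eigenvalues of the design -/

/-- The linear map `V ↦ n^(-1/2) X V`, where `X` is the `n × q` design matrix with rows `xᵢ`. -/
noncomputable def designMap {n q : ℕ} (p : ℕ) (x : Fin n → Fin q → ℝ) :
    (Fin q × Fin p → ℝ) →ₗ[ℝ] EuclideanSpace ℝ (Fin n × Fin p) where
  toFun w := WithLp.toLp 2 fun e => 1 / √(n : ℝ) * ∑ a, x e.1 a * w (a, e.2)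
  map_add' w w' := by
    ext e
    simp [mul_add, Finset.sum_add_distrib]
  map_smul' c w := by
    ext e
    simp only [Pi.smul_apply, smul_eq_mul, PiLp.smul_apply, RingHom.id_apply, Finset.mul_sum]
    exact Finset.sum_congr rfl fun a _ => by ring

/-- The seminorm `V ↦ √tr(Vᵀ S V)` on coefficient matrices, where `S` is the second moment matrix
of the covariates. -/
noncomputable def designSeminorm {n q : ℕ} (p : ℕ) (x : Fin n → Fin q → ℝ) :
    Seminorm ℝ (Fin q × Fin p → ℝ) :=
  (normSeminorm ℝ (EuclideanSpace ℝ (Fin n × Fin p))).comp (designMap p x)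

lemma designSeminorm_sq {n p q : ℕ} (x : Fin n → Fin q → ℝ) (w : Fin q × Fin p → ℝ) :
    designSeminorm p x w ^ 2 = energy x 1 (Matrix.of fun a j => w (a, j)) := by
  rw [energy_one_eq, designSeminorm, Seminorm.comp_apply, coe_normSeminorm,
    EuclideanSpace.norm_sq_eq, Fintype.sum_prod_type, Finset.mul_sum]
  refine Finset.sum_congr rfl fun i _ => ?_
  rw [Finset.mul_sum]
  refine Finset.sum_congr rfl fun j _ => ?_
  simp [designMap, mul_apply, mul_pow, Real.sq_sqrt]

/-- The Euclidean norm, as a seminorm on functions. -/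
noncomputable def euclidSeminorm (ι : Type*) [Fintype ι] : Seminorm ℝ (ι → ℝ) :=
  (normSeminorm ℝ (EuclideanSpace ℝ ι)).comp (WithLp.linearEquiv 2 ℝ (ι → ℝ)).symm.toLinearMap

lemma euclidSeminorm_eq {ι : Type*} [Fintype ι] (w : ι → ℝ) :
    euclidSeminorm ι w = √(∑ i, w i ^ 2) := by
  rw [euclidSeminorm, Seminorm.comp_apply, coe_normSeminorm, EuclideanSpace.norm_eq]
  simp

lemma sum_indicator_sq {ι : Type*} [Fintype ι] [DecidableEq ι] (I : Finset ι) (v : ι → ℝ) :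
    ∑ i, ((I : Set ι).indicator v i) ^ 2 = ∑ i ∈ I, v i ^ 2 := by
  rw [← Finset.sum_subset (Finset.subset_univ I) fun i _ hi => by simp [hi]]
  exact Finset.sum_congr rfl fun i hi => by simp [hi]

section RestrictedEigenvalue

variable {n p q : ℕ} {t : Truth p q} {h : Hyper} {x : Fin n → Fin q → ℝ}

lemma energy_one_eq_sum (V : Matrix (Fin q) (Fin p) ℝ) :
    energy x 1 V = ∑ j, Vᵀ j ⬝ᵥ crossMoment x x *ᵥ Vᵀ j := by
  rw [← trace_mul_mul_transpose, energy, inv_one, Matrix.one_mul, transpose_transpose]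

/-- The restricted isometry property, applied to the columns of a sparse coefficient matrix. -/
lemma designSeminorm_indicator_bounds (ht : t.Valid) (hR : RIP t h x)
    (v : Fin q × Fin p → ℝ) {I : Finset (Fin q × Fin p)} (hI : I.card ≤ sparsity t h) :
    t.rho1 * ∑ e ∈ I, v e ^ 2 ≤ designSeminorm p x ((I : Set _).indicator v) ^ 2 ∧
      designSeminorm p x ((I : Set _).indicator v) ^ 2 ≤ t.rho2 * ∑ e ∈ I, v e ^ 2 := by
  set w := (I : Set (Fin q × Fin p)).indicator v with hw
  have hcol : ∀ j, hammingNorm (fun a => w (a, j)) ≤ sparsity t h := by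
    intro j
    refine le_trans ?_ hI
    refine Finset.card_le_card_of_injOn (fun a => (a, j)) ?_ ?_
    · intro a ha
      simp only [Finset.coe_filter, Finset.mem_univ, true_and, Set.mem_ofPred_eq] at ha
      exact Set.mem_of_indicator_ne_zero ha
    · intro a _ b _ hab
      exact (Prod.mk.inj hab).1
  have hsum : ∑ e ∈ I, v e ^ 2 = ∑ j, (fun a => w (a, j)) ⬝ᵥ (fun a => w (a, j)) := by
    rw [← sum_indicator_sq, Fintype.sum_prod_type_right]
    simp only [dotProduct, ← sq, hw]
  rw [designSeminorm_sq, energy_one_eq_sum, hsum, Finset.mul_sum, Finset.mul_sum]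
  have hnn : ∀ u : Fin q → ℝ, 0 ≤ u ⬝ᵥ u := fun u => by simpa using dotProduct_self_star_nonneg u
  constructor
  · refine Finset.sum_le_sum fun j _ => ?_
    change _ ≤ (fun a => w (a, j)) ⬝ᵥ crossMoment x x *ᵥ (fun a => w (a, j))
    set u := fun a => w (a, j)
    by_cases hu : u = 0
    · simp [hu]
    refine le_trans ?_ (hR.lower u hu (hcol j))
    have h1 := lamMin_mul_le ht.Cov_pos.isHermitian u
    have h2 := mul_le_mul_of_nonneg_right (rho1_le_lamMin (t := t)) (hnn u)
    linarith
  · refine Finset.sum_le_sum fun j _ => ?_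
    change (fun a => w (a, j)) ⬝ᵥ crossMoment x x *ᵥ (fun a => w (a, j)) ≤ _
    set u := fun a => w (a, j)
    by_cases hu : u = 0
    · simp [hu]
    refine (hR.upper u hu (hcol j)).trans ?_
    have h1 := le_lamMax_mul ht.Cov_pos.isHermitian u
    unfold Truth.rho2
    linarith

/-- The restricted eigenvalue bound. On the cone where the entries of `v` off the signal set have
`ℓ¹` norm at most `α √|S| δ`, everything off some `s₀`-sparse set is negligible, and the design is
well conditioned on that set. -/
lemma exists_restricted_eigenvalue (hp : 0 < p) (hq : 0 < q) (ht : t.Valid) (hh : h.Valid)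
    (hR : RIP t h x) (v : Fin q × Fin p → ℝ) {δ : ℝ}
    (hcone : ∑ e ∈ t.SΘrowᶜ, |v e| ≤ h.alpha * (√(t.Srow.card : ℝ) * δ)) :
    ∃ I : Finset (Fin q × Fin p), t.SΘrow ⊆ I ∧ √(∑ e ∈ Iᶜ, v e ^ 2) ≤ δ / 2 ∧
      √t.rho1 * (√(∑ e ∈ I, v e ^ 2) - δ / 2) ≤ designSeminorm p x v := by
  have hρ1 := rho1_pos hp hq ht
  have hρ12 := rho1_le_rho2 hq ht
  have hρ2 := hρ1.trans_le hρ12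
  have hα : 0 < h.alpha := zero_lt_one.trans_le (one_le_alpha hh)
  have hs : (0 : ℝ) < t.Srow.card := by exact_mod_cast Srow_card_pos hp ht
  set k := ⌈4 * (t.rho2 / t.rho1) * h.alpha ^ 2 * (t.Srow.card : ℝ)⌉₊
  have hk0 : 0 < k := Nat.ceil_pos.2 (by positivity)
  have hsk : sparsity t h = t.Srow.card + k := rfl
  have hkle : 2 * (√t.rho2 / √t.rho1) * (h.alpha * √(t.Srow.card : ℝ)) ≤ √(k : ℝ) := by
    refine Real.le_sqrt_of_sq_le ?_
    refine le_trans (le_of_eq ?_) (Nat.le_ceil _)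
    rw [mul_pow, mul_pow, mul_pow, div_pow, Real.sq_sqrt hρ1.le, Real.sq_sqrt hρ2.le,
      Real.sq_sqrt hs.le]
    ring
  obtain ⟨J, hJS, hJk, hJ⟩ := exists_block_seminorm_le v hk0 t.SΘrowᶜ
  -- the bound on the remainder, for a seminorm with constant `c`
  have hrem : ∀ (N : Seminorm ℝ (Fin q × Fin p → ℝ)) (c : ℝ), 0 ≤ c →
      (∀ I : Finset (Fin q × Fin p), I.card ≤ k →
        N ((I : Set _).indicator v) ≤ c * √(∑ e ∈ I, v e ^ 2)) →
      N (((t.SΘrowᶜ \ J : Finset _) : Set _).indicator v) * (2 * (√t.rho2 / √t.rho1)) ≤ c * δ := by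
    intro N c hc hN
    have h1 := hJ N c hc fun I _ hI => hN I hI
    have h2 : N (((t.SΘrowᶜ \ J : Finset _) : Set _).indicator v) *
        (2 * (√t.rho2 / √t.rho1)) * (h.alpha * √(t.Srow.card : ℝ)) ≤
        c * δ * (h.alpha * √(t.Srow.card : ℝ)) := by
      calc _ = N (((t.SΘrowᶜ \ J : Finset _) : Set _).indicator v) *
            (2 * (√t.rho2 / √t.rho1) * (h.alpha * √(t.Srow.card : ℝ))) := by ring
        _ ≤ N (((t.SΘrowᶜ \ J : Finset _) : Set _).indicator v) * √(k : ℝ) := by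
            gcongr
        _ ≤ _ := h1
        _ ≤ c * (h.alpha * (√(t.Srow.card : ℝ) * δ)) := by gcongr
        _ = _ := by ring
    exact le_of_mul_le_mul_right h2 (by positivity)
  have hcompl : (t.SΘrow ∪ J)ᶜ = t.SΘrowᶜ \ J := by
    ext e; simp
  have hr1 : 0 < √t.rho1 := Real.sqrt_pos.2 hρ1
  have hr2 : 0 < √t.rho2 := Real.sqrt_pos.2 hρ2
  refine ⟨t.SΘrow ∪ J, Finset.subset_union_left, ?_, ?_⟩
  · have h1 := hrem (euclidSeminorm _) 1 zero_le_one fun I _ => by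
      rw [euclidSeminorm_eq, sum_indicator_sq, one_mul]
    rw [euclidSeminorm_eq, sum_indicator_sq] at h1
    rw [hcompl]
    have h2 : 1 ≤ √t.rho2 / √t.rho1 := by
      rw [le_div_iff₀ hr1, one_mul]
      exact Real.sqrt_le_sqrt hρ12
    have h3 := Real.sqrt_nonneg (∑ e ∈ t.SΘrowᶜ \ J, v e ^ 2)
    nlinarith
  · have h1 := hrem (designSeminorm p x) (√t.rho2) hr2.le fun I hI => by
      have h2 := (designSeminorm_indicator_bounds ht hR v (I := I) (by rw [hsk]; omega)).2
      rw [← Real.sqrt_mul hρ2.le]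
      exact Real.le_sqrt_of_sq_le h2
    rw [← hcompl] at h1
    have h2 : designSeminorm p x ((((t.SΘrow ∪ J)ᶜ : Finset _) : Set _).indicator v) ≤
        √t.rho1 * (δ / 2) := by
      have h3 : designSeminorm p x ((((t.SΘrow ∪ J)ᶜ : Finset _) : Set _).indicator v) *
          (2 * (√t.rho2 / √t.rho1)) ≤ √t.rho1 * (δ / 2) * (2 * (√t.rho2 / √t.rho1)) := by
        refine h1.trans (le_of_eq ?_)
        field_simp
      exact le_of_mul_le_mul_right h3 (by positivity)
    have hcard : (t.SΘrow ∪ J).card ≤ sparsity t h := by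
      have := Finset.card_union_le t.SΘrow J
      have := Srow_card (t := t)
      rw [hsk]
      omega
    have h3 : √t.rho1 * √(∑ e ∈ t.SΘrow ∪ J, v e ^ 2) ≤
        designSeminorm p x (((t.SΘrow ∪ J : Finset _) : Set _).indicator v) := by
      rw [← Real.sqrt_mul hρ1.le]
      exact Real.sqrt_le_iff.2 ⟨apply_nonneg _ _,
        (designSeminorm_indicator_bounds ht hR v hcard).1⟩
    have h4 : designSeminorm p x (((t.SΘrow ∪ J : Finset _) : Set _).indicator v) ≤
        designSeminorm p x v +
          designSeminorm p x ((((t.SΘrow ∪ J)ᶜ : Finset _) : Set _).indicator v) := by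
      have : ((t.SΘrow ∪ J : Finset _) : Set _).indicator v =
          v - (((t.SΘrow ∪ J)ᶜ : Finset _) : Set _).indicator v := by
        rw [Finset.coe_compl, Set.indicator_compl, sub_sub_cancel]
      rw [this]
      exact map_sub_le_add _ _ _
    linarith

end RestrictedEigenvalue

/-! ### Curvature of the log-likelihood on the cone -/

/-- The remainder of the linear expansion of the normalized negative log-likelihood at the truth,
as given by `logLik_sub_eq`. -/
noncomputable def divergence {n p q : ℕ} (t : Truth p q) (x : Fin n → Fin q → ℝ)
    (Θ : Matrix (Fin q) (Fin p) ℝ) (Λ : Matrix (Fin p) (Fin p) ℝ) : ℝ :=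
  (Real.log t.Λ.det - Real.log Λ.det + (t.Λ⁻¹ * (Λ - t.Λ)).trace) +
    energy x Λ ((Θ - t.Θ) - t.Θ * t.Λ⁻¹ * (Λ - t.Λ))

lemma sum_sq_le_of_cone {x y z f : ℝ} (hx : 0 ≤ x) (hy : 0 ≤ y)
    (hyδ : y ≤ √(x ^ 2 + z ^ 2) / 2) (hfδ : x - √(x ^ 2 + z ^ 2) / 2 ≤ f) :
    (x ^ 2 + y ^ 2 + z ^ 2) / 160 ≤ z ^ 2 / 4 + 0.238 * f ^ 2 := by
  set δ := √(x ^ 2 + z ^ 2)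
  have hδ0 : 0 ≤ δ := Real.sqrt_nonneg _
  have hδsq : δ ^ 2 = x ^ 2 + z ^ 2 := Real.sq_sqrt (by positivity)
  have hy2 : y ^ 2 ≤ δ ^ 2 / 4 := by nlinarith
  rcases le_total (x ^ 2) (z ^ 2) with hxz | hxz
  · nlinarith [sq_nonneg f]
  · have h1 : δ ≤ 1.42 * x := abs_le_of_sq_le_sq' (by nlinarith) (by positivity) |>.2
    have h2 : 0.29 * x ≤ f := by linarith
    have h3 : (0.29 * x) ^ 2 ≤ f ^ 2 := by gcongr
    nlinarith

/-- One half of `N / 4` pays for the perturbation `z` of the precision matrix; the other half,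
together with `a`, pays for the perturbation `f` of the coefficients. -/
lemma mul_le_quarter_add {κ r L N a b z f : ℝ} (hκ0 : 0 ≤ κ) (hκ1 : κ ≤ 1) (hr : 0 ≤ r)
    (hL : 0 < L) (hrL : r * L ≤ 0.5) (ha : 0 ≤ a) (hz : z ^ 2 ≤ L ^ 2 * N)
    (hf : r * f ^ 2 ≤ L * (2 * a + 2 * b)) (hb : κ * b ≤ 4.2 / 16 * N) :
    κ * r / L * (z ^ 2 / 4 + 0.238 * f ^ 2) ≤ N / 4 + a := by
  have hN : 0 ≤ N := nonneg_of_mul_nonneg_right ((sq_nonneg z).trans hz) (by positivity)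
  have h1 : κ * r / L * (z ^ 2 / 4) ≤ N / 8 := by
    rw [div_mul_eq_mul_div, div_le_iff₀ hL]
    have h2 : r * z ^ 2 ≤ 0.5 * (L * N) := by
      calc r * z ^ 2 ≤ r * (L ^ 2 * N) := by gcongr
        _ = r * L * (L * N) := by ring
        _ ≤ _ := by gcongr
    have h3 : κ * (r * z ^ 2) ≤ 1 * (r * z ^ 2) := by gcongr
    linarith
  have h4 : κ * r / L * (0.238 * f ^ 2) ≤ 0.238 * (2 * (κ * a) + 2 * (κ * b)) := by
    rw [div_mul_eq_mul_div, div_le_iff₀ hL]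
    calc κ * r * (0.238 * f ^ 2) = 0.238 * κ * (r * f ^ 2) := by ring
      _ ≤ 0.238 * κ * (L * (2 * a + 2 * b)) := by gcongr
      _ = _ := by ring
  have h5 : κ * a ≤ 1 * a := by gcongr
  rw [mul_add]
  linarith

section Curvature

variable {n p q : ℕ} {t : Truth p q} {h : Hyper} {x : Fin n → Fin q → ℝ}

lemma lamMin_Λ_mul_le (ht : t.Valid) (u : Fin p → ℝ) :
    lamMin t.Λ * (u ⬝ᵥ u) ≤ u ⬝ᵥ t.Λ *ᵥ u := lamMin_mul_le ht.Λ_pos.isHermitian u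

/-- Lower bound on the divergence by the energies of the two blocks at the truth. -/
lemma trace_add_energy_le_divergence (hp : 0 < p) (ht : t.Valid) {Λ : Matrix (Fin p) (Fin p) ℝ}
    (hΛ : Λ.PosDef) (Θ : Matrix (Fin q) (Fin p) ℝ) {z : ℝ} (hz : 0 ≤ z)
    (hzΛ : ∑ i, ∑ j, (Λ i j - t.Λ i j) ^ 2 ≤ z ^ 2) :
    (t.Λ⁻¹ * (Λ - t.Λ) * t.Λ⁻¹ * (Λ - t.Λ)).trace / 4 +
        energy x t.Λ ((Θ - t.Θ) - t.Θ * t.Λ⁻¹ * (Λ - t.Λ)) ≤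
      (1 + z / lamMin t.Λ) * divergence t x Θ Λ := by
  have hl := lamMin_pos hp ht.Λ_pos
  have hκ : 1 ≤ 1 + z / lamMin t.Λ := by
    have : 0 ≤ z / lamMin t.Λ := by positivity
    linarith
  have hκ0 := zero_lt_one.trans_le hκ
  have hle := quadForm_le_one_add_mul hl hz (lamMin_Λ_mul_le ht) hzΛ
  have h1 := logDet_divergence_ge ht.Λ_pos hΛ hκ hle
  have h2 := energy_le x ht.Λ_pos hΛ hκ0 hle ((Θ - t.Θ) - t.Θ * t.Λ⁻¹ * (Λ - t.Λ))
  rw [div_le_iff₀ (by positivity)] at h1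
  unfold divergence
  rw [mul_add]
  linarith

lemma trace_inv_mul_nonneg (ht : t.Valid) {Δ : Matrix (Fin p) (Fin p) ℝ} (hΔ : Δᵀ = Δ) :
    0 ≤ (t.Λ⁻¹ * Δ * t.Λ⁻¹ * Δ).trace := by
  -- any upper bound on `t.Λ` will do; this one is positive even for `p = 0`
  have hL : 0 < |lamMax t.Λ| + 1 := by positivity
  have h1 := sum_sq_le_trace ht.Λ_pos hΔ hL fun u =>
    (le_lamMax_mul ht.Λ_pos.isHermitian u).trans (mul_le_mul_of_nonneg_right
      ((le_abs_self _).trans (lt_add_one _).le) (by simpa using dotProduct_self_star_nonneg u))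
  have h2 : 0 ≤ ∑ i, ∑ j, Δ i j ^ 2 :=
    Finset.sum_nonneg fun _ _ => Finset.sum_nonneg fun _ _ => sq_nonneg _
  exact nonneg_of_mul_nonneg_right (h2.trans h1) (by positivity)

lemma isSymm_sub (ht : t.Valid) {Λ : Matrix (Fin p) (Fin p) ℝ} (hΛ : Λ.PosDef) :
    (Λ - t.Λ)ᵀ = Λ - t.Λ := by
  rw [transpose_sub, isSymm_of_isHermitian hΛ.isHermitian,
    isSymm_of_isHermitian ht.Λ_pos.isHermitian]

lemma divergence_nonneg (hp : 0 < p) (ht : t.Valid) {Λ : Matrix (Fin p) (Fin p) ℝ}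
    (hΛ : Λ.PosDef) (Θ : Matrix (Fin q) (Fin p) ℝ) : 0 ≤ divergence t x Θ Λ := by
  have hS : 0 ≤ ∑ i, ∑ j, (Λ i j - t.Λ i j) ^ 2 :=
    Finset.sum_nonneg fun _ _ => Finset.sum_nonneg fun _ _ => sq_nonneg _
  have h1 := trace_add_energy_le_divergence (x := x) hp ht hΛ Θ (Real.sqrt_nonneg _)
    (Real.sq_sqrt hS).ge
  have h2 := trace_inv_mul_nonneg ht (isSymm_sub ht hΛ)
  have h3 := energy_nonneg x ht.Λ_pos ((Θ - t.Θ) - t.Θ * t.Λ⁻¹ * (Λ - t.Λ))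
  have hl := lamMin_pos hp ht.Λ_pos
  exact nonneg_of_mul_nonneg_right (by linarith :
    0 ≤ (1 + √(∑ i, ∑ j, (Λ i j - t.Λ i j) ^ 2) / lamMin t.Λ) * _) (by positivity)

/-- The sum of the squared entries of `(Θ, Λ) - (Θ⁰, Λ⁰)` over the signal set. -/
noncomputable def signalSq (t : Truth p q) (Θ : Matrix (Fin q) (Fin p) ℝ)
    (Λ : Matrix (Fin p) (Fin p) ℝ) : ℝ :=
  ∑ e ∈ t.SΘrow, (Θ e.1 e.2 - t.Θ e.1 e.2) ^ 2 + ∑ e ∈ t.SΛ, (Λ e.1 e.2 - t.Λ e.1 e.2) ^ 2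

/-- The sum of the absolute entries of `(Θ, Λ) - (Θ⁰, Λ⁰)` over the signal set. -/
noncomputable def signalAbs (t : Truth p q) (Θ : Matrix (Fin q) (Fin p) ℝ)
    (Λ : Matrix (Fin p) (Fin p) ℝ) : ℝ :=
  ∑ e ∈ t.SΘrow, |Θ e.1 e.2 - t.Θ e.1 e.2| + ∑ e ∈ t.SΛ, |Λ e.1 e.2 - t.Λ e.1 e.2|

lemma signalAbs_le (Θ : Matrix (Fin q) (Fin p) ℝ) (Λ : Matrix (Fin p) (Fin p) ℝ) :
    signalAbs t Θ Λ ≤ √(t.Srow.card : ℝ) * √(signalSq t Θ Λ) := by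
  set f : (Fin q × Fin p) ⊕ (Fin p × Fin p) → ℝ :=
    Sum.elim (fun e => |Θ e.1 e.2 - t.Θ e.1 e.2|) (fun e => |Λ e.1 e.2 - t.Λ e.1 e.2|) with hf
  have h1 : signalAbs t Θ Λ = ∑ e ∈ t.Srow, f e := by
    rw [Truth.Srow, Finset.sum_disjSum]
    simp [hf, signalAbs]
  have h2 : signalSq t Θ Λ = ∑ e ∈ t.Srow, f e ^ 2 := by
    rw [Truth.Srow, Finset.sum_disjSum]
    simp [hf, signalSq]
  rw [h1, h2, ← Real.sqrt_mul (Nat.cast_nonneg _)]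
  exact Real.le_sqrt_of_sq_le sq_sum_le_card_mul_sum_sq

/-- On the cone, the divergence grows at least quadratically; the factor `1 + z / λ_min(Λ⁰)`, with
`z = ‖Λ - Λ⁰‖_F`, makes the bound hold at all distances from the truth. -/
lemma beta0_mul_le_divergence (hp : 0 < p) (hq : 0 < q) (ht : t.Valid) (hh : h.Valid)
    (hR : RIP t h x) {Λ : Matrix (Fin p) (Fin p) ℝ} (hΛ : Λ.PosDef)
    (Θ : Matrix (Fin q) (Fin p) ℝ)
    (hcone : ∑ e ∈ t.SΘrowᶜ, |Θ e.1 e.2 - t.Θ e.1 e.2| ≤ h.alpha * signalAbs t Θ Λ) :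
    t.beta0 * frobDist t (Θ, Λ) ^ 2 / 4 ≤
      (1 + frobDist t (Θ, Λ) / lamMin t.Λ) * divergence t x Θ Λ := by
  set v : Fin q × Fin p → ℝ := fun e => Θ e.1 e.2 - t.Θ e.1 e.2
  set Δ := Λ - t.Λ with hΔ
  have hΔs : Δᵀ = Δ := isSymm_sub ht hΛ
  have hZ : 0 ≤ ∑ i, ∑ j, (Λ i j - t.Λ i j) ^ 2 :=
    Finset.sum_nonneg fun _ _ => Finset.sum_nonneg fun _ _ => sq_nonneg _
  have hV : 0 ≤ ∑ i, ∑ j, (Θ i j - t.Θ i j) ^ 2 :=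
    Finset.sum_nonneg fun _ _ => Finset.sum_nonneg fun _ _ => sq_nonneg _
  set z := √(∑ i, ∑ j, (Λ i j - t.Λ i j) ^ 2)
  have hzsq : z ^ 2 = ∑ i, ∑ j, (Λ i j - t.Λ i j) ^ 2 := Real.sq_sqrt hZ
  have hz0 : 0 ≤ z := Real.sqrt_nonneg _
  have hzd : z ≤ frobDist t (Θ, Λ) := Real.sqrt_le_sqrt (by simpa using hV)
  have hd : frobDist t (Θ, Λ) ^ 2 = ∑ e, v e ^ 2 + z ^ 2 := by
    rw [frobDist, Real.sq_sqrt (add_nonneg hV hZ), hzsq, Fintype.sum_prod_type]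
  have hα := zero_le_one.trans (one_le_alpha hh)
  have hl := lamMin_pos hp ht.Λ_pos
  have hL := lamMax_Λ_pos hp ht
  have hρ1 := rho1_pos hp hq ht
  have hτ := signal_pos ht
  have hl3 := lamMin_pos hp (posDef_three_smul ht)
  -- the restricted eigenvalue bound, with `δ` enlarged to involve all of `Λ - Λ⁰`
  have hδle : ∀ I : Finset (Fin q × Fin p), t.SΘrow ⊆ I →
      √(signalSq t Θ Λ) ≤ √(∑ e ∈ I, v e ^ 2 + z ^ 2) := by
    intro I hI
    refine Real.sqrt_le_sqrt (add_le_add ?_ ?_)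
    · exact Finset.sum_le_sum_of_subset_of_nonneg hI fun _ _ _ => sq_nonneg _
    · rw [hzsq, ← Fintype.sum_prod_type' (f := fun i j => (Λ i j - t.Λ i j) ^ 2)]
      exact Finset.sum_le_sum_of_subset_of_nonneg (Finset.subset_univ _)
        fun _ _ _ => sq_nonneg _
  obtain ⟨I, hSI, hrest, hmain⟩ := exists_restricted_eigenvalue hp hq ht hh hR v
    (δ := √(signalSq t Θ Λ)) (hcone.trans (mul_le_mul_of_nonneg_left (signalAbs_le Θ Λ) hα))
  set X := √(∑ e ∈ I, v e ^ 2)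
  set Y := √(∑ e ∈ Iᶜ, v e ^ 2)
  have hXsq : X ^ 2 = ∑ e ∈ I, v e ^ 2 := Real.sq_sqrt (Finset.sum_nonneg fun _ _ => sq_nonneg _)
  have hYsq : Y ^ 2 = ∑ e ∈ Iᶜ, v e ^ 2 := Real.sq_sqrt (Finset.sum_nonneg fun _ _ => sq_nonneg _)
  have hδ := hδle I hSI
  rw [← hXsq] at hδ
  set f := designSeminorm p x v / √t.rho1 with hf
  have hr1 := Real.sqrt_pos.2 hρ1
  have hX0 : 0 ≤ X := Real.sqrt_nonneg _
  have hY0 : 0 ≤ Y := Real.sqrt_nonneg _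
  have hfl : X - √(X ^ 2 + z ^ 2) / 2 ≤ f := by
    rw [hf, le_div_iff₀' hr1]
    refine le_trans (mul_le_mul_of_nonneg_left ?_ hr1.le) hmain
    linarith
  have hnum := sum_sq_le_of_cone hX0 hY0
    (by linarith : Y ≤ √(X ^ 2 + z ^ 2) / 2) hfl
  have hd' : frobDist t (Θ, Λ) ^ 2 = X ^ 2 + Y ^ 2 + z ^ 2 := by
    rw [hd, hXsq, hYsq, Finset.sum_add_sum_compl]
  -- the curvature of the likelihood
  have hcurv := trace_add_energy_le_divergence (x := x) hp ht hΛ Θ hz0 hzsq.ge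
  rw [← hΔ] at hcurv
  set N := (t.Λ⁻¹ * Δ * t.Λ⁻¹ * Δ).trace
  set a := energy x t.Λ ((Θ - t.Θ) - t.Θ * t.Λ⁻¹ * Δ)
  set b := energy x t.Λ (t.Θ * t.Λ⁻¹ * Δ)
  have ha0 : 0 ≤ a := energy_nonneg x ht.Λ_pos _
  set κ := min 1 (lamMin ((3 : ℝ) • t.Λ) / (16 * t.signal)) with hκ
  have hκ0 : 0 < κ := lt_min one_pos (by positivity)
  have hκ1 : κ ≤ 1 := min_le_left _ _
  have hκ2 : κ ≤ lamMin ((3 : ℝ) • t.Λ) / (16 * t.signal) := min_le_right _ _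
  have hbN : κ * b ≤ 4.2 / 16 * N := by
    have hHs : (t.Θᵀ * crossMoment x x * t.Θ).IsHermitian := by
      have : (crossMoment x x).IsHermitian := by
        rw [Matrix.IsHermitian, conjTranspose_eq_transpose_of_trivial, isSymm_crossMoment]
      have := isHermitian_conjTranspose_mul_mul t.Θ this
      rwa [conjTranspose_eq_transpose_of_trivial] at this
    have h1 := energy_mul_inv_mul_le x t.Θ ht.Λ_pos hΔs
      (l := lamMin ((3 : ℝ) • t.Λ) / 3) (σ := 1.4 * t.signal) (by positivity) (by positivity)
      (fun u => by
        have := lamMin_mul_le (posDef_three_smul ht).isHermitian u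
        rw [smul_mulVec, dotProduct_smul, smul_eq_mul] at this
        linarith)
      (fun u => (le_lamMax_mul hHs u).trans (mul_le_mul_of_nonneg_right hR.signal
        (by simpa using dotProduct_self_star_nonneg u)))
    calc κ * b ≤ lamMin ((3 : ℝ) • t.Λ) / (16 * t.signal) *
          (1.4 * t.signal / (lamMin ((3 : ℝ) • t.Λ) / 3) * N) :=
            mul_le_mul hκ2 h1 (energy_nonneg x ht.Λ_pos _) (by positivity)
      _ = 4.2 / 16 * N := by field_simp; ring
  have hab : energy x t.Λ (Θ - t.Θ) ≤ 2 * a + 2 * b := energy_le_two_mul_add x ht.Λ_pos _ _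
  have hNz : z ^ 2 ≤ lamMax t.Λ ^ 2 * N := by
    rw [hzsq]
    exact sum_sq_le_trace ht.Λ_pos hΔs hL (le_lamMax_mul ht.Λ_pos.isHermitian)
  have hE : t.rho1 * f ^ 2 ≤ lamMax t.Λ * energy x t.Λ (Θ - t.Θ) := by
    have h1 : t.rho1 * f ^ 2 = energy x 1 (Θ - t.Θ) := by
      rw [hf, div_pow, Real.sq_sqrt hρ1.le, mul_div_cancel₀ _ hρ1.ne', designSeminorm_sq]
      rfl
    rw [h1]
    exact energy_le x PosDef.one ht.Λ_pos hL
      (fun u => by simpa using le_lamMax_mul ht.Λ_pos.isHermitian u) _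
  have hρL : t.rho1 * lamMax t.Λ ≤ 0.5 := by
    have := mul_le_mul_of_nonneg_right (rho1_le_inv (t := t)) hL.le
    rwa [mul_assoc, inv_mul_cancel₀ hL.ne', mul_one] at this
  have hpay := mul_le_quarter_add hκ0.le hκ1 hρ1.le hL hρL ha0 hNz (hE.trans
    (mul_le_mul_of_nonneg_left hab hL.le)) hbN
  have hβ : t.beta0 * frobDist t (Θ, Λ) ^ 2 / 4 ≤ N / 4 + a := by
    calc t.beta0 * frobDist t (Θ, Λ) ^ 2 / 4
        = κ * t.rho1 / lamMax t.Λ * ((X ^ 2 + Y ^ 2 + z ^ 2) / 160) := by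
          rw [hd', Truth.beta0, ← hκ]
          field_simp
          ring
      _ ≤ κ * t.rho1 / lamMax t.Λ * (z ^ 2 / 4 + 0.238 * f ^ 2) := by gcongr
      _ ≤ _ := hpay
  have hD0 : 0 ≤ divergence t x Θ Λ := divergence_nonneg hp ht hΛ Θ
  calc _ ≤ _ := hβ
    _ ≤ _ := hcurv
    _ ≤ _ := by gcongr

/-! ### The high posterior density region -/

/-- Points of the HPD region satisfy the basic inequality: the penalty off the signal set
absorbs the gradient of the log-likelihood. -/
lemma divergence_le_of_mem_HPD {y : Fin n → Fin p → ℝ} (ht : t.Valid) (hh : h.Valid)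
    (hG : 2 * gradSup x y t.Θ t.Λ < 1 / h.ν1)
    {Φ : Matrix (Fin q) (Fin p) ℝ × Matrix (Fin p) (Fin p) ℝ} (hΦ : Φ ∈ HPD h t x y) :
    (n : ℝ) / 2 * divergence t x Φ.1 Φ.2 ≤
      (1 / h.ν0 + 1 / (2 * h.ν1)) * signalAbs t Φ.1 Φ.2 -
        1 / (2 * h.ν1) * ∑ e ∈ t.SΘrowᶜ, |Φ.1 e.1 e.2 - t.Θ e.1 e.2| := by
  obtain ⟨hΛ, -, hpost⟩ := hΦ
  have hν0 := hh.ν0_pos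
  have hν1 := hν0.trans_le hh.ν_le
  have h1 := logLik_sub_eq x y t.Θ Φ.1 ht.Λ_pos hΛ
  have h2 := dirDeriv_le x y t.Θ t.Λ (Φ.1 - t.Θ) (Φ.2 - t.Λ)
  have h3 := log_priorΘ_sub_le hh t Φ.1
  have h4 := log_priorΛ_sub_le hh ht (isSymm_of_isHermitian hΛ.isHermitian)
  unfold negLogPost at hpost
  simp only [Matrix.sub_apply] at h2
  rw [← Finset.sum_add_sum_compl t.SΘrow, ← Finset.sum_add_sum_compl t.SΛ] at h2
  set A := ∑ e ∈ t.SΘrow, |Φ.1 e.1 e.2 - t.Θ e.1 e.2|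
  set B := ∑ e ∈ t.SΘrowᶜ, |Φ.1 e.1 e.2 - t.Θ e.1 e.2|
  set A' := ∑ e ∈ t.SΛ, |Φ.2 e.1 e.2 - t.Λ e.1 e.2|
  set B' := ∑ e ∈ t.SΛᶜ, |Φ.2 e.1 e.2 - t.Λ e.1 e.2|
  have hA0 : 0 ≤ A := Finset.sum_nonneg fun _ _ => abs_nonneg _
  have hB0 : 0 ≤ B := Finset.sum_nonneg fun _ _ => abs_nonneg _
  have hA0' : 0 ≤ A' := Finset.sum_nonneg fun _ _ => abs_nonneg _
  have hB0' : 0 ≤ B' := Finset.sum_nonneg fun _ _ => abs_nonneg _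
  have hg : gradSup x y t.Θ t.Λ ≤ 1 / (2 * h.ν1) := by
    have : 1 / (2 * h.ν1) = 1 / h.ν1 / 2 := by field_simp
    linarith
  have h5 := h2.trans (mul_le_mul_of_nonneg_right hg (by positivity))
  have h6 : A' / (2 * h.ν0) ≤ A' * (1 / h.ν0) := by
    rw [mul_one_div]
    gcongr
    linarith
  have e1 : A / h.ν0 = 1 / h.ν0 * A := by ring
  have e2 : B / h.ν1 = 2 * (1 / (2 * h.ν1) * B) := by field_simp
  have e3 : B' / (2 * h.ν1) = 1 / (2 * h.ν1) * B' := by ring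
  have hs : signalAbs t Φ.1 Φ.2 = A + A' := rfl
  change logLik x y Φ.1 Φ.2 - logLik x y t.Θ t.Λ = _ - (n : ℝ) / 2 * divergence t x Φ.1 Φ.2 at h1
  rw [hs]
  linarith

lemma rate_pos (hp : 0 < p) (hq : 0 < q) (ht : t.Valid) {C : ℝ} (hC : 0 < C) (hn : 0 < n) :
    0 < t.rate C n := by
  have h1 := beta0_pos hp hq ht
  have h2 := log_add_pos hp hq
  have h3 : (0 : ℝ) < t.Srow.card := by exact_mod_cast Srow_card_pos hp ht
  have h4 : (0 : ℝ) < n := by exact_mod_cast hn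
  unfold Truth.rate
  positivity

/-- The constant of the contraction rate: the bounds on the divergence give `C ≤ 12 c (1 + √(2/m))`
as soon as some point of the HPD region is further than the rate from the truth. -/
noncomputable def rateConst (c m : ℝ) : ℝ := 12 * c * (1 + √(2 / m)) + 1

lemma rateConst_pos {c m : ℝ} (hc : 0 < c) : 0 < rateConst c m := by
  unfold rateConst
  positivity

/-- Deterministic contraction: for good data, the whole HPD region lies within the rate. -/
lemma HPDWithin_of_goodData {y : Fin n → Fin p → ℝ} {c m : ℝ} (hc : 0 < c) (hm : 0 < m)
    (hp : 0 < p) (hq : 0 < q) (hn : 0 < n) (ht : t.Valid) (hml : m ≤ lamMin t.Λ)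
    (hh : h.Valid) (hspec : specNorm t.Λ < h.R)
    (hν : 1 / (n * h.ν0) ≤ c * √(Real.log ((p : ℝ) + q) / n))
    (hRbound : h.R < 2 * lamMax t.Λ * √t.r0 / t.rate (rateConst c m) n)
    (hgood : GoodData t h x y) : HPDWithin t h x y (t.rate (rateConst c m) n) := by
  intro Φ hΦ
  by_contra! hlt
  set C := rateConst c m with hC
  have hC0 : 0 < C := rateConst_pos hc
  set ε := t.rate C n with hε
  have hε0 : 0 < ε := rate_pos hp hq ht hC0 hn
  set d := frobDist t Φ
  have hd0 : 0 < d := hε0.trans hlt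
  have hν0 := hh.ν0_pos
  have hν1 := hν0.trans_le hh.ν_le
  have hn' : (0 : ℝ) < n := by exact_mod_cast hn
  have hl := lamMin_pos hp ht.Λ_pos
  have hβ := beta0_pos hp hq ht
  have hL := lamMax_Λ_pos hp ht
  have hbasic := divergence_le_of_mem_HPD ht hh hgood.2 hΦ
  have hD0 : 0 ≤ divergence t x Φ.1 Φ.2 := divergence_nonneg hp ht hΦ.1 Φ.1
  set D := divergence t x Φ.1 Φ.2
  set s := signalAbs t Φ.1 Φ.2
  set B := ∑ e ∈ t.SΘrowᶜ, |Φ.1 e.1 e.2 - t.Θ e.1 e.2|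
  have hB0 : 0 ≤ B := Finset.sum_nonneg fun _ _ => abs_nonneg _
  have hnD : 0 ≤ (n : ℝ) / 2 * D := by positivity
  have hcone : B ≤ h.alpha * s := by
    have h1 : 1 / (2 * h.ν1) * B ≤ 1 / (2 * h.ν1) * (h.alpha * s) := by
      have : 1 / (2 * h.ν1) * (h.alpha * s) = (1 / h.ν0 + 1 / (2 * h.ν1)) * s := by
        unfold Hyper.alpha
        field_simp
        ring
      linarith
    exact le_of_mul_le_mul_left h1 (by positivity)
  have hlow := beta0_mul_le_divergence hp hq ht hh hgood.1 hΦ.1 Φ.1 hcone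
  change t.beta0 * d ^ 2 / 4 ≤ (1 + d / lamMin t.Λ) * D at hlow
  -- the upper bound on the divergence, in terms of the rate
  have hsd : s ≤ √(t.Srow.card : ℝ) * d := by
    refine (signalAbs_le _ _).trans (mul_le_mul_of_nonneg_left (Real.sqrt_le_sqrt ?_)
      (Real.sqrt_nonneg _))
    refine add_le_add ?_ ?_
    · rw [← Fintype.sum_prod_type' (f := fun i j => (Φ.1 i j - t.Θ i j) ^ 2)]
      exact Finset.sum_le_sum_of_subset_of_nonneg (Finset.subset_univ _)
        fun _ _ _ => sq_nonneg _
    · rw [← Fintype.sum_prod_type' (f := fun i j => (Φ.2 i j - t.Λ i j) ^ 2)]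
      exact Finset.sum_le_sum_of_subset_of_nonneg (Finset.subset_univ _)
        fun _ _ _ => sq_nonneg _
  have hs0 : 0 ≤ s := add_nonneg (Finset.sum_nonneg fun _ _ => abs_nonneg _)
    (Finset.sum_nonneg fun _ _ => abs_nonneg _)
  have hrate : √(t.Srow.card : ℝ) * √(Real.log ((p : ℝ) + q) / n) = t.beta0 * ε / C := by
    rw [← Real.sqrt_mul (Nat.cast_nonneg _), hε, Truth.rate, mul_div_assoc]
    field_simp
  have hup : D ≤ 3 * c * (t.beta0 * ε / C) * d := by
    have h1 : (n : ℝ) / 2 * D ≤ 3 / (2 * h.ν0) * s := by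
      have h2 : 1 / h.ν0 + 1 / (2 * h.ν1) ≤ 3 / (2 * h.ν0) := by
        have : 1 / (2 * h.ν1) ≤ 1 / (2 * h.ν0) := by
          have := hh.ν_le
          gcongr
        have e : 3 / (2 * h.ν0) = 1 / h.ν0 + 1 / (2 * h.ν0) := by field_simp; norm_num
        linarith
      have h3 := mul_le_mul_of_nonneg_right h2 hs0
      have h4 : 0 ≤ 1 / (2 * h.ν1) * B := by positivity
      linarith
    have h2 : D ≤ 3 * (1 / (n * h.ν0)) * s := by
      have e : 3 * (1 / (n * h.ν0)) * s = 3 / (2 * h.ν0) * s / ((n : ℝ) / 2) := by field_simp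
      rw [e, le_div_iff₀ (by positivity)]
      linarith
    calc D ≤ 3 * (1 / (n * h.ν0)) * s := h2
      _ ≤ 3 * (c * √(Real.log ((p : ℝ) + q) / n)) * (√(t.Srow.card : ℝ) * d) := by gcongr
      _ = 3 * c * (√(t.Srow.card : ℝ) * √(Real.log ((p : ℝ) + q) / n)) * d := by ring
      _ = _ := by rw [hrate]
  -- the bound on `R` only serves to bound the rate by a multiple of `λ_min(Λ⁰)`
  have hεl : ε / lamMin t.Λ ≤ √(2 / m) := by
    have h1 : h.R * ε < 2 * lamMax t.Λ * √t.r0 := by rwa [lt_div_iff₀ hε0] at hRbound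
    have h2 : lamMax t.Λ < h.R := (lamMax_le_specNorm hp ht.Λ_pos.isHermitian).trans_lt hspec
    have h3 : ε < 2 * √t.r0 := by
      have : lamMax t.Λ * ε < lamMax t.Λ * (2 * √t.r0) := by
        calc lamMax t.Λ * ε < h.R * ε := by gcongr
          _ < _ := h1
          _ = _ := by ring
      exact lt_of_mul_lt_mul_left this hL.le
    have h4 : √t.r0 ≤ √(0.5 * lamMin t.Λ) := Real.sqrt_le_sqrt (min_le_left _ _)
    refine Real.le_sqrt_of_sq_le ?_
    rw [div_pow, div_le_div_iff₀ (by positivity) hm]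
    have h5 : ε ^ 2 ≤ 2 * lamMin t.Λ := by
      have h6 : ε ≤ 2 * √(0.5 * lamMin t.Λ) := by linarith
      calc ε ^ 2 ≤ (2 * √(0.5 * lamMin t.Λ)) ^ 2 := by gcongr
        _ = _ := by rw [mul_pow, Real.sq_sqrt (by positivity)]; ring
    calc ε ^ 2 * m ≤ 2 * lamMin t.Λ * lamMin t.Λ := by gcongr
      _ = _ := by ring
  -- since `ε < d`, the factor `1 + d / λ_min(Λ⁰)` is at most linear in `d`
  have hfac : (1 + d / lamMin t.Λ) * ε ≤ (1 + √(2 / m)) * d := by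
    have h1 : d / lamMin t.Λ * ε = ε / lamMin t.Λ * d := by ring
    have h2 : ε / lamMin t.Λ * d ≤ √(2 / m) * d := by gcongr
    linarith
  have hfin : t.beta0 * d ^ 2 * C ≤ t.beta0 * d ^ 2 * (12 * c * (1 + √(2 / m))) := by
    have h1 : t.beta0 * d ^ 2 / 4 ≤ 3 * c * (t.beta0 * d / C) * ((1 + √(2 / m)) * d) := by
      calc _ ≤ _ := hlow
        _ ≤ (1 + d / lamMin t.Λ) * (3 * c * (t.beta0 * ε / C) * d) := by gcongr
        _ = 3 * c * (t.beta0 * d / C) * ((1 + d / lamMin t.Λ) * ε) := by ring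
        _ ≤ _ := by gcongr
    have e : 3 * c * (t.beta0 * d / C) * ((1 + √(2 / m)) * d) =
        t.beta0 * d ^ 2 * (12 * c * (1 + √(2 / m))) / 4 / C := by
      field_simp
      ring
    rw [e, le_div_iff₀ hC0] at h1
    linarith
  have := le_of_mul_le_mul_left hfin (by positivity)
  rw [hC, rateConst] at this
  linarith

end Curvature

lemma pos_of_sampleSize {n p q : ℕ} {t : Truth p q} {h : Hyper} {ε0 : ℝ} (hp : 0 < p)
    (hq : 0 < q) (hε0 : 0 < ε0) (hS : SampleSize t h n ε0) : 0 < n := by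
  have h1 := log_add_pos hp hq
  have h2 : (0 : ℝ) < p := by exact_mod_cast hp
  have : (0 : ℝ) < n := lt_of_le_of_lt (by positivity) hS
  exact_mod_cast this

/-! ### The rate tends to zero -/

lemma tendsto_rate_fixed {p q : ℕ} (t : Truth p q) (C : ℝ) :
    Tendsto (fun n => t.rate C n) atTop (𝓝 0) := by
  have h1 := tendsto_const_div_atTop_nhds_zero_nat
    ((t.Srow.card : ℝ) * Real.log ((p : ℝ) + q))
  have h2 := ((Real.continuous_sqrt.tendsto 0).comp h1).const_mul (C / t.beta0)
  rw [Real.sqrt_zero, mul_zero] at h2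
  exact h2

lemma tendsto_rate {C b : ℝ} (hC : 0 < C) (hb : 0 < b) {p q : ℕ → ℕ} (hp : ∀ n, 0 < p n)
    (hq : ∀ n, 0 < q n) (t : ∀ n, Truth (p n) (q n)) (h : ℕ → Hyper)
    (hβ : ∀ n, b ≤ (t n).beta0)
    (hS : ∀ ε0 ∈ Set.Ioo (0 : ℝ) 1, ∀ᶠ n in atTop, SampleSize (t n) (h n) n ε0) :
    Tendsto (fun n => (t n).rate C n) atTop (𝓝 0) := by
  set u : ℕ → ℝ := fun n => ((t n).Srow.card : ℝ) * Real.log ((p n : ℝ) + q n) / n with hu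
  have hlog : ∀ n, 0 < Real.log ((p n : ℝ) + q n) := fun n => log_add_pos (hp n) (hq n)
  have hu0 : ∀ n, 0 ≤ u n := fun n => by
    have := hlog n
    positivity
  have hut : Tendsto u atTop (𝓝 0) := by
    rw [Metric.tendsto_atTop']
    intro ε hε
    have hmem : min ε 1 / 2 ∈ Set.Ioo (0 : ℝ) 1 := by
      have := min_le_right ε 1
      constructor
      · positivity
      · linarith
    obtain ⟨N, hN⟩ := eventually_atTop.1 (hS _ hmem)
    refine ⟨N, fun n hn => ?_⟩
    have h1 := hN n hn.le
    rw [SampleSize, div_lt_iff₀ hmem.1] at h1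
    have hn0 : (0 : ℝ) < n := by exact_mod_cast (Nat.zero_le N).trans_lt hn
    have h2 : ((t n).Srow.card : ℝ) ≤ (p n : ℝ) + sparsity (t n) (h n) := by
      have : ((t n).Srow.card : ℝ) ≤ sparsity (t n) (h n) := by
        exact_mod_cast Nat.le_add_right _ _
      have : (0 : ℝ) ≤ p n := Nat.cast_nonneg _
      linarith
    have h3 := mul_le_mul_of_nonneg_right h2 (hlog n).le
    rw [Real.dist_eq, sub_zero, abs_of_nonneg (hu0 n), hu, div_lt_iff₀ hn0]
    have h4 : (n : ℝ) * (min ε 1 / 2) ≤ ε * n := by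
      have h5 : min ε 1 / 2 ≤ ε := by
        have := min_le_left ε 1
        linarith
      rw [mul_comm]
      gcongr
    linarith
  have hlim := ((Real.continuous_sqrt.tendsto 0).comp hut).const_mul (C / b)
  rw [Real.sqrt_zero, mul_zero] at hlim
  refine squeeze_zero (fun n => ?_) (fun n => ?_) hlim
  · exact mul_nonneg (div_nonneg hC.le (hb.le.trans (hβ n))) (Real.sqrt_nonneg _)
  · refine mul_le_mul_of_nonneg_right ?_ (Real.sqrt_nonneg _)
    have := hβ n
    gcongr

end GCRF

theorem theorem1 (c₀ c₁ m : ℝ) (hc₀ : 0 < c₀) (hc₁ : 0 < c₁) (hm : 0 < m) :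
    ∃ C : ℝ, 0 < C ∧
      -- the bound, for every model, sample size and choice of hyperparameters
      (∀ {Ω : Type*} [MeasurableSpace Ω] (μ : Measure Ω) [IsProbabilityMeasure μ]
          (n p q : ℕ) (_ : 0 < p) (_ : 0 < q)
          (t : Truth p q) (_ : t.Valid) (_ : m ≤ lamMin t.Λ)
          (X : Fin n → Ω → Fin q → ℝ) (Y : Fin n → Ω → Fin p → ℝ) (_ : IsSample μ t X Y)
          (h : Hyper) (_ : h.Valid) (_ : specNorm t.Λ < h.R)
          (ε0 : ℝ) (_ : ε0 ∈ Set.Ioo (0 : ℝ) 1)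
          (_ : SampleSize t h n ε0)
          (_ : 1 / (n * h.ν0) ≤ c₀ * √(Real.log ((p : ℝ) + q) / n))
          (_ : 1 / (n * h.ν1) ≤ c₁ * √(Real.log ((p : ℝ) + q) / n))
          (_ : h.R < 2 * lamMax t.Λ * √t.r0 / t.rate C n),
          (∀ᵐ ω ∂μ, GoodData t h (fun i => X i ω) (fun i => Y i ω) →
            HPDWithin t h (fun i => X i ω) (fun i => Y i ω) (t.rate C n)) ∧
          (μ {ω | ¬ GoodData t h (fun i => X i ω) (fun i => Y i ω)} ≤ ENNReal.ofReal ε0 →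
            μ {ω | ¬ HPDWithin t h (fun i => X i ω) (fun i => Y i ω) (t.rate C n)}
              ≤ ENNReal.ofReal ε0)) ∧
      -- the rate tends to zero, for a fixed model
      (∀ (p q : ℕ) (t : Truth p q), t.Valid → Tendsto (fun n => t.rate C n) atTop (𝓝 0)) ∧
      -- the rate tends to zero, for models that grow with the sample size
      (∀ (p q : ℕ → ℕ) (_ : ∀ n, 0 < p n) (_ : ∀ n, 0 < q n)
          (t : ∀ n, Truth (p n) (q n)) (_ : ∀ n, (t n).Valid)
          (h : ℕ → Hyper) (_ : ∀ n, (h n).Valid)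
          (b : ℝ) (_ : 0 < b) (_ : ∀ n, b ≤ (t n).beta0)
          (_ : ∀ ε0 ∈ Set.Ioo (0 : ℝ) 1, ∀ᶠ n in atTop, SampleSize (t n) (h n) n ε0),
          Tendsto (fun n => (t n).rate C n) atTop (𝓝 0)) := by
  refine ⟨rateConst c₀ m, rateConst_pos hc₀, ?_, fun p q t _ => tendsto_rate_fixed t _,
    fun p q hp hq t _ h _ b hb hβ hS => tendsto_rate (rateConst_pos hc₀) hb hp hq t h hβ hS⟩
  intro Ω _ μ _ n p q hp hq t ht hml X Y _ h hh hspec ε0 hε0 hS hν _ hR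
  have key : ∀ ω, GoodData t h (fun i => X i ω) (fun i => Y i ω) →
      HPDWithin t h (fun i => X i ω) (fun i => Y i ω) (t.rate (rateConst c₀ m) n) := fun ω =>
    HPDWithin_of_goodData hc₀ hm hp hq (pos_of_sampleSize hp hq hε0.1 hS) ht hml hh hspec hν hR
  refine ⟨ae_of_all μ key, fun hμ => (measure_mono fun ω hω => ?_).trans hμ⟩
  exact fun hgood => hω (key ω hgood)
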